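/- Let $G$ be a finite simple graph, $k\ge 0$ an integer and $\mathcal I\subseteq V(G)$. A path decomposition $(X_1,\dots,X_l)$, $l\ge 1$, of $G$ (width $\max_i|X_i|-1$) is \emph{connected} if $G[X_1\cup\dots\cup X_i]$ is connected for all $1\le i\le l$, and \emph{$\mathcal I$-connected} if every connected component of $G[X_1\cup\dots\cup X_i]$ contains a vertex of $\mathcal I$ for all $1\le i\le l$. The connected pathwidth $\mathrm{cpw}(G)$ is the minimum width of a connected path decomposition of $G$ ($\infty$ if there is none). $N_G(Y)$ is the set of vertices outside $Y$ with a neighbour in $Y$. An \emph{$S$-branch} is a connected component $H$ of $G-S$ with $N_G(V(H))=S$; $\mathcal B(S)$ is the set of $S$-branches. A non-empty set $S$ is a \emph{bottleneck} if $|\mathcal B(S)|\ge 2k+1$. A \emph{potential state} is a triple $s=(X,\{B_S\},\{f_S\})$, with $S$ ranging over the non-empty subsets of $X$, where $\emptyset\ne X\subseteq V(G)$, $|X|\le k$, $B_S\subseteq\mathcal B(S)$, $|B_S|\le 2k$, and $f_S:\mathcal B(S)\to\{0,1\}$ is constant on $\mathcal B(S)\setminus B_S$. Put $\mathrm{bag}(s)=X$,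 let $\mathrm{cover}(s)$ be the union of $X$ and of all $V(H)$ with $H\in\mathcal B(S)$, $\emptyset\neq S\subseteq X$, $f_S(H)=1$, and let $\mathrm{border}(s)$ be the set of vertices of $\mathrm{cover}(s)$ with a neighbour outside $\mathrm{cover}(s)$. It is a \emph{state} if every connected component of $G[\mathrm{cover}(s)]$ contains a vertex of $\mathcal I$. Fix any strict total order $\prec$ on the states such that $w\prec s$ whenever $|\mathrm{cover}(w)|<|\mathrm{cover}(s)|$, or $|\mathrm{cover}(w)|=|\mathrm{cover}(s)|$ and $|\mathrm{bag}(w)|>|\mathrm{bag}(s)|$ (ties are resolved arbitrarily). The Boolean table $Tab$ is initialised by $Tab[s]=true$ iff $\mathrm{cover}(s)=\mathrm{bag}(s)=\{v\}$ for some $v\in\mathcal I$. Then the states $s$ are processed in the order $\prec$: $Tab[s]$ is set to $true$ if $|\mathrm{cover}(s)|>1$ and there is a state $w\prec s$ with $Tab[w]=true$ and $(\mathrm{cover}(w),\mathrm{bag}(w))\ne(\mathrm{cover}(s),\mathrm{bag}(s))$ to which one of the following applies. \emph{Step extension:} every connected component of $G[\mathrm{bag}(s)]$ contains a vertex of $\mathrm{bag}(w)$;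 $\mathrm{border}(w)\subseteq \mathrm{bag}(s)$; $\mathrm{cover}(s)=\mathrm{cover}(w)\cup \mathrm{bag}(s)$; and $\mathrm{bag}(s)\cap \mathrm{cover}(w)\subseteq \mathrm{bag}(w)$. \emph{Jump extension:} $w=(X,\{B_S\},\{f_S\})$ and $s=(X,\{B_S\},\{g_S\})$ have the same $X$ and the same $B_S$, and there is a bottleneck $S'\subseteq X$ such that $f_{S'}(H)=0$ and $g_{S'}(H)=1$ for all $H\in\mathcal B(S')\setminus B_{S'}$; $f_{S'}=g_{S'}$ on $B_{S'}$; $f_S=g_S$ for every non-empty $S\subseteq X$ with $S\ne S'$; and every $H\in\mathcal B(S')\setminus B_{S'}$ has an $(N_G(S')\cap V(H))$-connected path decomposition of width at most $k-|X|-1$. \textbf{Corollary.} The algorithm is correct. For every $s^*\in V(G)$, the table computed with $\mathcal I=\{s^*\}$ satisfies: $Tab[s]=true$ for some state $s$ with $\mathrm{cover}(s)=V(G)$ if and only if $G$ has an $\{s^*\}$-connected path decomposition of width at most $k-1$. Consequently, $\mathrm{cpw}(G)\le k-1$ if and only if, for some $s^*\in V(G)$, the table computed with $\mathcal I=\{s^*\}$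 has $Tab[s]=true$ for some state $s$ with $\mathrm{cover}(s)=V(G)$. -/

import Mathlib

namespace ConnPW

/-- The neighbourhood `N_G(Y)`: the vertices outside `Y` that are adjacent to a vertex of `Y`. -/
def nbhd {V : Type*} (G : SimpleGraph V) (Y : Set V) : Set V :=
  {v | v ∉ Y ∧ ∃ u ∈ Y, G.Adj u v}

/-- Every connected component of the induced subgraph `G[U]` contains a vertex of `I`. -/
def ComponentsMeet {V : Type*} (G : SimpleGraph V) (U I : Set V) : Prop :=
  ∀ C : (G.induce U).ConnectedComponent, ∃ v : U, v ∈ C.supp ∧ (v : V) ∈ I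

/-- The union of the sets in a list. -/
def unionOf {V : Type*} (P : List (Set V)) : Set V :=
  {v | ∃ X ∈ P, v ∈ X}

/-- `P = (X₁, …, X_l)`, `l ≥ 1`, is a path decomposition of `G`. -/
structure IsPathDecomposition {V : Type*} (G : SimpleGraph V) (P : List (Set V)) : Prop where
  ne_nil : P ≠ []
  covers : unionOf P = Set.univ
  edges : ∀ u v, G.Adj u v → ∃ X ∈ P, u ∈ X ∧ v ∈ X
  interval : ∀ (i j m : ℕ) (hij : i ≤ j) (hjm : j ≤ m) (hm : m < P.length),
    P[i] ∩ P[m] ⊆ P[j]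

/-- The maximum bag size minus one (for graphs on a finite vertex set). -/
noncomputable def width {V : Type*} (P : List (Set V)) : ℤ :=
  (((P.map Set.ncard).foldr max 0 : ℕ) : ℤ) - 1

/-- `P` is connected: `G[X₁ ∪ ⋯ ∪ X_i]` is connected for every `1 ≤ i ≤ l`. -/
def IsConnectedSeq {V : Type*} (G : SimpleGraph V) (P : List (Set V)) : Prop :=
  ∀ i, 1 ≤ i → i ≤ P.length → (G.induce (unionOf (P.take i))).Connected

/-- `P` is `I`-connected: every connected component of `G[X₁ ∪ ⋯ ∪ X_i]` contains a vertex
of `I`, for every `1 ≤ i ≤ l`. -/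
def IsRootedSeq {V : Type*} (G : SimpleGraph V) (I : Set V) (P : List (Set V)) : Prop :=
  ∀ i, 1 ≤ i → i ≤ P.length → ComponentsMeet G (unionOf (P.take i)) I

/-- There is an `I`-connected path decomposition of `G` of width at most `r`. -/
def HasRootedDecomposition {V : Type*} (G : SimpleGraph V) (I : Set V) (r : ℤ) : Prop :=
  ∃ P : List (Set V), IsPathDecomposition G P ∧ IsRootedSeq G I P ∧ width P ≤ r

/-- The connected pathwidth: the minimum width of a connected path decomposition, and `⊤` if
there is none. (The width of a connected path decomposition is never negative, because its
first bag is non-empty.) -/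
noncomputable def cpw {V : Type*} (G : SimpleGraph V) : ℕ∞ :=
  ⨅ (P : List (Set V)) (_ : IsPathDecomposition G P ∧ IsConnectedSeq G P),
    ((width P).toNat : ℕ∞)

/-- The `S`-branches, each given by its vertex set: the connected components `H` of `G - S`
with `N_G(V(H)) = S`. -/
def branches {V : Type*} (G : SimpleGraph V) (S : Set V) : Set (Set V) :=
  {H | (∃ C : (G.induce Sᶜ).ConnectedComponent, H = Subtype.val '' C.supp) ∧ nbhd G H = S}

/-- `S` is a bottleneck: a non-empty set with at least `2k + 1` branches. -/
def IsBottleneck {V : Type*} (G : SimpleGraph V) (k : ℕ) (S : Set V) : Prop :=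
  S.Nonempty ∧ 2 * k + 1 ≤ (branches G S).ncard

/-- A potential state `(X, {B_S}, {f_S})`, where `S` ranges over the non-empty subsets of `X`. -/
structure PotentialState {V : Type*} (G : SimpleGraph V) (k : ℕ) where
  bag : Set V
  bag_nonempty : bag.Nonempty
  bag_card : bag.ncard ≤ k
  B : ∀ S : Set V, S.Nonempty → S ⊆ bag → Set (branches G S)
  B_card : ∀ S hne hS, (B S hne hS).ncard ≤ 2 * k
  f : ∀ S : Set V, S.Nonempty → S ⊆ bag → branches G S → Bool
  f_const : ∀ S hne hS, ∀ H ∉ B S hne hS, ∀ H' ∉ B S hne hS, f S hne hS H = f S hne hS H'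

/-- `cover(s)`: the bag together with all branches of value `1`. -/
def PotentialState.cover {V : Type*} {G : SimpleGraph V} {k : ℕ} (s : PotentialState G k) :
    Set V :=
  s.bag ∪ {v | ∃ (S : Set V) (hne : S.Nonempty) (hS : S ⊆ s.bag) (H : branches G S),
    s.f S hne hS H = true ∧ v ∈ (H : Set V)}

/-- `border(s)`: the vertices of `cover(s)` that have a neighbour outside `cover(s)`. -/
def PotentialState.border {V : Type*} {G : SimpleGraph V} {k : ℕ} (s : PotentialState G k) :
    Set V :=
  {v | v ∈ s.cover ∧ ∃ u, u ∉ s.cover ∧ G.Adj v u}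

/-- A state: a potential state such that every connected component of `G[cover(s)]` contains a
vertex of `I`. -/
structure State {V : Type*} (G : SimpleGraph V) (k : ℕ) (I : Set V)
    extends PotentialState G k where
  rooted : ComponentsMeet G toPotentialState.cover I

/-- The states differ in their bags or in their covers. -/
def Distinguishable {V : Type*} {G : SimpleGraph V} {k : ℕ} {I : Set V}
    (w s : State G k I) : Prop :=
  ¬ (w.cover = s.cover ∧ w.bag = s.bag)

/-- The order in which the states are processed: a total order in which `w` precedes `s` whenever
`|cover(w)| < |cover(s)|`, or `|cover(w)| = |cover(s)|` and `|bag(w)| > |bag(s)|`, with an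
arbitrary resolution of ties; `states` lists all states in this order. -/
structure ProcessingOrder {V : Type*} (G : SimpleGraph V) (k : ℕ) (I : Set V) where
  prec : State G k I → State G k I → Prop
  strictTotal : IsStrictTotalOrder (State G k I) prec
  prec_of_cover : ∀ w s : State G k I, w.cover.ncard < s.cover.ncard → prec w s
  prec_of_bag : ∀ w s : State G k I, w.cover.ncard = s.cover.ncard →
    s.bag.ncard < w.bag.ncard → prec w s
  states : List (State G k I)
  sorted : states.Pairwise prec
  complete : ∀ s, s ∈ states

/-- The conditions of the step extension from `w` to `s`. -/
structure StepExt {V : Type*} {G : SimpleGraph V} {k : ℕ} {I : Set V}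
    (w s : State G k I) : Prop where
  components : ComponentsMeet G s.bag w.bag
  border : w.border ⊆ s.bag
  cover : s.cover = w.cover ∪ s.bag
  bag : s.bag ∩ w.cover ⊆ w.bag

/-- The conditions of the jump extension from `w = (X, {B_S}, {f_S})` to
`s = (X, {B_S}, {g_S})`. -/
def JumpExt {V : Type*} {G : SimpleGraph V} {k : ℕ} {I : Set V} (w s : State G k I) : Prop :=
  w.bag = s.bag ∧
  (∀ S hne hw hs, w.B S hne hw = s.B S hne hs) ∧
  ∃ (S' : Set V) (hne : S'.Nonempty) (hw : S' ⊆ w.bag) (hs : S' ⊆ s.bag),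
    IsBottleneck G k S' ∧
    (∀ H ∉ w.B S' hne hw, w.f S' hne hw H = false ∧ s.f S' hne hs H = true) ∧
    (∀ H ∈ w.B S' hne hw, w.f S' hne hw H = s.f S' hne hs H) ∧
    (∀ S hSne hSw hSs, S ≠ S' → ∀ H, w.f S hSne hSw H = s.f S hSne hSs H) ∧
    (∀ H ∉ w.B S' hne hw,
      HasRootedDecomposition (G.induce (H : Set V)) {v | (v : V) ∈ nbhd G S'}
        ((k : ℤ) - w.bag.ncard - 1))

/-- The initial table: `Tab[s]` is true iff `cover(s) = bag(s) = {v}` for some `v ∈ I`. -/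
def initTab {V : Type*} {G : SimpleGraph V} {k : ℕ} {I : Set V} (s : State G k I) : Prop :=
  ∃ v ∈ I, s.cover = {v} ∧ s.bag = {v}

/-- Processing the state `s`: if `|cover(s)| > 1` and one of the two extension rules applies to
`s` and an earlier state `w` with `Tab[w]` true, then `Tab[s]` is set to true. -/
def process {V : Type*} {G : SimpleGraph V} {k : ℕ} {I : Set V} (ord : ProcessingOrder G k I)
    (T : State G k I → Prop) (s : State G k I) : State G k I → Prop :=
  fun t => T t ∨ (t = s ∧ 1 < s.cover.ncard ∧
    ∃ w, ord.prec w s ∧ Distinguishable w s ∧ T w ∧ (StepExt w s ∨ JumpExt w s))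

/-- The table after all states have been processed in the given order. -/
def Tab {V : Type*} {G : SimpleGraph V} {k : ℕ} {I : Set V} (ord : ProcessingOrder G k I) :
    State G k I → Prop :=
  ord.states.foldl (process ord) initTab

end ConnPW

namespace ConnPW

/-! Soundness. A true entry `s` certifies an `I`-connected decomposition of `G[cover(s)]`, with bags
of size at most `k`, whose last bag is `bag(s)` (`HasPartial`). A step extension appends one bag. A
jump extension runs through the non-exceptional branches of the bottleneck one after another, adding
the fixed bag to every bag of the branch's own decomposition; since that decomposition is rooted at
neighbours of the bottleneck, which lies in the fixed bag, everything stays `I`-connected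
(`HasPartial.append_branch`).

Completeness. Fix a decomposition `X` rooted at `v` with `X 0 = {v}`. A state can treat only `2k`
branches of each `S` individually, while `X` may interleave many. For a bottleneck `S`, call a
branch inner if each bag meeting it lies strictly between bags containing any given vertex of `S`;
every such bag then contains `S`. The other branches all meet one of two fixed bags, so there are at
most `2k` of them (`ncard_not_inner_le`), and they serve as `B_S`.

Let `D` be the union of all inner branches. Deleting `D` from the bags keeps the prefixes rooted at
`v`, and each vertex of `D` lies in an inner branch of a top bottleneck, one disjoint from `D`. All
inner branches of a top bottleneck `S` can be handled at a single moment: at a bag `X t` containing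
`S` with `|X t \ D|` minimal. Indeed a bag `X j` that meets such a branch `H` contains at least `|X
t \ D|` vertices outside `H`, so `X` restricted to `H` fits beside `X t \ D`. The table therefore
follows the bags `X i \ D` by step extensions and absorbs the inner branches of each top bottleneck
by one jump at its place `t`. The processing order is no obstacle: in these extensions the cover
grows, or it stays and the bag shrinks. -/

open Relation

/-! ### Walks inside vertex sets, and branches -/

variable {V : Type*} {G : SimpleGraph V}

/-- `x` and `y` are joined by a walk of `G` whose edges lie inside `U`. -/
def Conn (G : SimpleGraph V) (U : Set V) : V → V → Prop :=
  ReflTransGen fun a b => a ∈ U ∧ b ∈ U ∧ G.Adj a b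

/-- Any two vertices of `H` are joined by a walk inside `H`. -/
def ConnSet (G : SimpleGraph V) (H : Set V) : Prop :=
  ∀ x ∈ H, ∀ y ∈ H, Conn G H x y

theorem Conn.mono {U W : Set V} (h : U ⊆ W) {x y : V} (hc : Conn G U x y) : Conn G W x y :=
  ReflTransGen.mono (p := fun a b => a ∈ W ∧ b ∈ W ∧ G.Adj a b)
    (fun _ _ hab => ⟨h hab.1, h hab.2.1, hab.2.2⟩) _ _ hc

theorem Conn.symm {U : Set V} {x y : V} (hc : Conn G U x y) : Conn G U y x := by
  induction hc with
  | refl => exact ReflTransGen.refl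
  | tail _ h ih => exact ReflTransGen.head ⟨h.2.1, h.1, h.2.2.symm⟩ ih

theorem Conn.mem {U : Set V} {x y : V} (hc : Conn G U x y) (hx : x ∈ U) : y ∈ U := by
  induction hc with
  | refl => exact hx
  | tail _ h _ => exact h.2.1

/-- A walk starting outside `A` avoids `A` or enters `A` along an edge. -/
theorem Conn.sdiff_or_exists_crossing {U A : Set V} {x y : V} (hc : Conn G U x y) (hxU : x ∈ U)
    (hx : x ∉ A) : (Conn G (U \ A) x y ∧ y ∈ U ∧ y ∉ A) ∨
      ∃ a b, Conn G (U \ A) x a ∧ a ∈ U ∧ a ∉ A ∧ b ∈ U ∧ b ∈ A ∧ G.Adj a b := by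
  induction hc with
  | refl => exact Or.inl ⟨ReflTransGen.refl, hxU, hx⟩
  | @tail b c _ h ih =>
    rcases ih with ⟨h1, h2, h3⟩ | ih
    · by_cases hcA : c ∈ A
      · exact Or.inr ⟨b, c, h1, h2, h3, h.2.1, hcA, h.2.2⟩
      · exact Or.inl ⟨h1.tail ⟨⟨h2, h3⟩, ⟨h.2.1, hcA⟩, h.2.2⟩, h.2.1, hcA⟩
    · exact Or.inr ih

/-- A walk from outside `A` into `A` enters `A` along an edge. -/
theorem Conn.exists_crossing {U A : Set V} {x y : V} (hc : Conn G U x y) (hxU : x ∈ U)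
    (hx : x ∉ A) (hy : y ∈ A) :
    ∃ a b, Conn G (U \ A) x a ∧ a ∈ U ∧ a ∉ A ∧ b ∈ U ∧ b ∈ A ∧ G.Adj a b :=
  (hc.sdiff_or_exists_crossing hxU hx).resolve_left fun h => h.2.2 hy

theorem reachable_induce_iff {U : Set V} (a b : U) :
    (G.induce U).Reachable a b ↔ Conn G U a b := by
  rw [SimpleGraph.reachable_iff_reflTransGen]
  constructor
  · intro h
    induction h with
    | refl => exact ReflTransGen.refl
    | @tail c d _ h ih => exact ih.tail ⟨c.2, d.2, h⟩
  · intro h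
    have key : ∀ y, Conn G U a y → ∀ hy : y ∈ U,
        ReflTransGen (G.induce U).Adj a ⟨y, hy⟩ := by
      intro y hy
      induction hy with
      | refl => intro _; exact ReflTransGen.refl
      | tail _ h ih => intro hy; exact (ih h.1).tail (by simpa using h.2.2)
    exact key b h b.2

theorem componentsMeet_iff {U I : Set V} :
    ComponentsMeet G U I ↔ ∀ x ∈ U, ∃ y ∈ U, y ∈ I ∧ Conn G U x y := by
  constructor
  · intro h x hx
    obtain ⟨y, hy, hyI⟩ := h ((G.induce U).connectedComponentMk ⟨x, hx⟩)
    refine ⟨y, y.2, hyI, ?_⟩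
    rw [SimpleGraph.ConnectedComponent.mem_supp_iff, SimpleGraph.ConnectedComponent.eq] at hy
    exact ((reachable_induce_iff _ _).1 hy).symm
  · intro h C
    induction C using SimpleGraph.ConnectedComponent.ind with
    | h x =>
      obtain ⟨y, hy, hyI, hc⟩ := h x x.2
      refine ⟨⟨y, hy⟩, ?_, hyI⟩
      rw [SimpleGraph.ConnectedComponent.mem_supp_iff, SimpleGraph.ConnectedComponent.eq]
      exact (reachable_induce_iff _ _).2 hc.symm

theorem componentsMeet_singleton_iff {U : Set V} {v : V} :
    ComponentsMeet G U {v} ↔ ∀ x ∈ U, v ∈ U ∧ Conn G U x v := by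
  rw [componentsMeet_iff]
  refine forall₂_congr fun x hx => ⟨?_, fun h => ⟨v, h.1, rfl, h.2⟩⟩
  rintro ⟨y, hy, rfl, hc⟩
  exact ⟨hy, hc⟩

/-- A walk leaving a connected set `H` must pass through its neighbourhood, so `H` is automatically
a full component of the complement of that neighbourhood. This removes induced subgraphs from the
treatment of branches. -/
theorem mem_branches_iff {S H : Set V} :
    H ∈ branches G S ↔ H.Nonempty ∧ ConnSet G H ∧ nbhd G H = S := by
  constructor
  · rintro ⟨⟨C, rfl⟩, hS⟩
    refine ⟨?_, ?_, hS⟩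
    · obtain ⟨x, hx⟩ := C.nonempty_supp
      exact ⟨x, x, hx, rfl⟩
    · rintro _ ⟨x, hx, rfl⟩ _ ⟨y, hy, rfl⟩
      have hr : (G.induce Sᶜ).Reachable x y := by
        rw [SimpleGraph.ConnectedComponent.mem_supp_iff] at hx hy
        exact SimpleGraph.ConnectedComponent.exact (hx.trans hy.symm)
      have key : ∀ z : ↥(Sᶜ), ReflTransGen (G.induce Sᶜ).Adj x z →
          Conn G (Subtype.val '' C.supp) x z ∧ z ∈ C.supp := by
        intro z hz
        induction hz with
        | refl => exact ⟨ReflTransGen.refl, hx⟩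
        | @tail c d _ h ih =>
          have hd : d ∈ C.supp := by
            have := ih.2
            rw [SimpleGraph.ConnectedComponent.mem_supp_iff] at this ⊢
            rw [← this, SimpleGraph.ConnectedComponent.eq]
            exact h.reachable.symm
          exact ⟨ih.1.tail ⟨⟨c, ih.2, rfl⟩, ⟨d, hd, rfl⟩, h⟩, hd⟩
      exact (key y ((SimpleGraph.reachable_iff_reflTransGen _ _).1 hr)).1
  · rintro ⟨⟨x, hx⟩, hc, rfl⟩
    have hsub : H ⊆ (nbhd G H)ᶜ := fun y hy hn => hn.1 hy
    refine ⟨⟨(G.induce (nbhd G H)ᶜ).connectedComponentMk ⟨x, hsub hx⟩, ?_⟩, rfl⟩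
    ext y
    constructor
    · intro hy
      refine ⟨⟨y, hsub hy⟩, ?_, rfl⟩
      rw [SimpleGraph.ConnectedComponent.mem_supp_iff, SimpleGraph.ConnectedComponent.eq,
        reachable_induce_iff]
      exact (hc y hy x hx).mono hsub
    · rintro ⟨z, hz, rfl⟩
      rw [SimpleGraph.ConnectedComponent.mem_supp_iff, SimpleGraph.ConnectedComponent.eq,
        reachable_induce_iff] at hz
      by_contra hzH
      obtain ⟨a, b, -, ha, haH, -, hb, hab⟩ := hz.exists_crossing z.2 hzH hx
      exact ha ⟨haH, b, hb, hab.symm⟩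

/-- A connected set that meets `H` and avoids the neighbourhood of `H` lies in `H`. -/
theorem ConnSet.subset_of_disjoint_nbhd {K H : Set V} (hK : ConnSet G K)
    (hd : Disjoint (nbhd G H) K) (hm : (K ∩ H).Nonempty) : K ⊆ H := by
  intro x hx
  by_contra hxH
  obtain ⟨y, hy, hyH⟩ := hm
  obtain ⟨a, b, -, ha, haH, -, hb, hab⟩ := (hK x hx y hy).exists_crossing hx hxH hyH
  exact Set.disjoint_left.1 hd ⟨haH, b, hb, hab.symm⟩ ha

/-- The set of vertices reachable from `x` inside `U` is connected. -/
theorem connSet_conn (U : Set V) (x : V) : ConnSet G {y | Conn G U x y} := by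
  have key : ∀ y, Conn G U x y → Conn G {y | Conn G U x y} x y := by
    intro y hy
    induction hy with
    | refl => exact ReflTransGen.refl
    | tail h1 h ih => exact ih.tail ⟨h1, h1.tail h, h.2.2⟩
  intro y hy z hz
  exact (key y hy).symm.trans (key z hz)

/-! ### Path decompositions as infinite sequences of bags -/

/-- The union of the bags with index at most `i`. -/
def prefixUnion (X : ℕ → Set V) (i : ℕ) : Set V := {w | ∃ j ≤ i, w ∈ X j}

theorem prefixUnion_mono (X : ℕ → Set V) {i j : ℕ} (h : i ≤ j) :
    prefixUnion X i ⊆ prefixUnion X j :=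
  fun _ ⟨m, hm, hw⟩ => ⟨m, hm.trans h, hw⟩

/-- `X` is an infinite sequence of bags forming an `I`-connected path decomposition of `G[C]`
with bags of size at most `k`. -/
structure IsSeqDecomposition (G : SimpleGraph V) (I : Set V) (k : ℕ) (C : Set V)
    (X : ℕ → Set V) : Prop where
  subset : ∀ i, X i ⊆ C
  covers : ∀ w ∈ C, ∃ i, w ∈ X i
  edges : ∀ u ∈ C, ∀ w ∈ C, G.Adj u w → ∃ i, u ∈ X i ∧ w ∈ X i
  interval : ∀ i j m, i ≤ j → j ≤ m → X i ∩ X m ⊆ X j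
  card : ∀ i, (X i).ncard ≤ k
  rooted : ∀ i, ComponentsMeet G (prefixUnion X i) I

theorem width_le_iff {P : List (Set V)} {k : ℕ} :
    width P ≤ (k : ℤ) - 1 ↔ ∀ X ∈ P, X.ncard ≤ k := by
  have key : (P.map Set.ncard).foldr max 0 ≤ k ↔ ∀ X ∈ P, X.ncard ≤ k := by
    induction P with
    | nil => simp
    | cons a P ih => simp [ih]
  rw [← key, width]
  omega

theorem unionOf_take (P : List (Set V)) (i : ℕ) :
    unionOf (P.take (i + 1)) = prefixUnion (fun i => P.getD i ∅) i := by
  ext w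
  simp only [unionOf, prefixUnion, Set.mem_ofPred_eq, List.mem_take_iff_getElem]
  constructor
  · rintro ⟨X, ⟨j, hj, rfl⟩, hw⟩
    refine ⟨j, by omega, ?_⟩
    rw [List.getD_eq_getElem _ _ (by omega)]
    exact hw
  · rintro ⟨j, hj, hw⟩
    by_cases hjl : j < P.length
    · rw [List.getD_eq_getElem _ _ hjl] at hw
      exact ⟨_, ⟨j, by omega, rfl⟩, hw⟩
    · rw [List.getD_eq_default _ _ (by omega)] at hw
      exact hw.elim

theorem HasRootedDecomposition.exists_seq {I : Set V} {k : ℕ}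
    (h : HasRootedDecomposition G I ((k : ℤ) - 1)) :
    ∃ X, IsSeqDecomposition G I k Set.univ X := by
  obtain ⟨P, hP, hR, hw⟩ := h
  rw [width_le_iff] at hw
  have hmem : ∀ X ∈ P, ∃ i, P.getD i ∅ = X := by
    intro X hX
    obtain ⟨i, hi, rfl⟩ := List.getElem_of_mem hX
    exact ⟨i, List.getD_eq_getElem _ _ hi⟩
  have hpos : 0 < P.length := List.length_pos_iff.2 hP.ne_nil
  refine ⟨fun i => P.getD i ∅, ⟨fun _ => Set.subset_univ _, ?_, ?_, ?_, ?_, ?_⟩⟩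
  · intro w _
    have : w ∈ unionOf P := hP.covers ▸ Set.mem_univ w
    obtain ⟨X, hX, hwX⟩ := this
    obtain ⟨i, rfl⟩ := hmem X hX
    exact ⟨i, hwX⟩
  · intro u _ w _ huw
    obtain ⟨X, hX, h1, h2⟩ := hP.edges u w huw
    obtain ⟨i, rfl⟩ := hmem X hX
    exact ⟨i, h1, h2⟩
  · intro i j m hij hjm
    by_cases hm : m < P.length
    · have := hP.interval i j m hij hjm hm
      simpa only [List.getD_eq_getElem P ∅ hm, List.getD_eq_getElem P ∅ (hjm.trans_lt hm),
        List.getD_eq_getElem P ∅ ((hij.trans hjm).trans_lt hm)] using this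
    · show P.getD i ∅ ∩ P.getD m ∅ ⊆ P.getD j ∅
      rw [List.getD_eq_default P ∅ (by omega : P.length ≤ m)]
      simp
  · intro i
    by_cases hi : i < P.length
    · simp only [List.getD_eq_getElem P ∅ hi]
      exact hw _ (List.getElem_mem _)
    · simp only [List.getD_eq_default P ∅ (by omega : P.length ≤ i)]
      simp
  · intro i
    by_cases hi : i < P.length
    · rw [← unionOf_take]
      exact hR (i + 1) (by omega) (by omega)
    -- Past the end of the list the padding bags are empty, so the prefix union is that of the whole
    -- list.
    · have := hR P.length hpos le_rfl
      rw [List.take_of_length_le le_rfl,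
        ← List.take_of_length_le (by omega : P.length ≤ i + 1), unionOf_take] at this
      exact this

/-- Finitely many vertices and edges need only finitely many bags, so an initial segment suffices.
The prefix unions are recorded so that both rootedness and connectedness can be transferred to the
list. -/
theorem exists_list_of_seq [Finite V] {I : Set V} {k : ℕ} {X : ℕ → Set V}
    (h : IsSeqDecomposition G I k Set.univ X) :
    ∃ P : List (Set V), IsPathDecomposition G P ∧ width P ≤ (k : ℤ) - 1 ∧
      ∀ i, 1 ≤ i → i ≤ P.length → unionOf (P.take i) = prefixUnion X (i - 1) := by
  have hv : ∀ w, ∃ i, w ∈ X i := fun w => h.covers w trivial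
  have he : ∀ p : V × V, ∃ i, G.Adj p.1 p.2 → p.1 ∈ X i ∧ p.2 ∈ X i := by
    intro p
    by_cases hp : G.Adj p.1 p.2
    · obtain ⟨i, hi⟩ := h.edges p.1 trivial p.2 trivial hp
      exact ⟨i, fun _ => hi⟩
    · exact ⟨0, fun h => absurd h hp⟩
  choose a ha using hv
  choose b hb using he
  obtain ⟨A, hA⟩ := (Set.finite_range a).bddAbove
  obtain ⟨B, hB⟩ := (Set.finite_range b).bddAbove
  have hA' : ∀ w, a w ≤ A := fun w => hA ⟨w, rfl⟩
  have hB' : ∀ p, b p ≤ B := fun p => hB ⟨p, rfl⟩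
  have hmem : ∀ i, i ≤ A + B → X i ∈ (List.range (A + B + 1)).map X := fun i hi =>
    List.mem_map.2 ⟨i, List.mem_range.2 (by omega), rfl⟩
  refine ⟨(List.range (A + B + 1)).map X, ⟨by simp, ?_, ?_, ?_⟩, ?_, ?_⟩
  · ext w
    simp only [Set.mem_univ, iff_true]
    exact ⟨X (a w), hmem _ (by have := hA' w; omega), ha w⟩
  · intro u w huw
    exact ⟨X (b (u, w)), hmem _ (by have := hB' (u, w); omega), hb (u, w) huw⟩
  · intro i j m hij hjm hm
    simp only [List.getElem_map, List.getElem_range]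
    exact h.interval i j m hij hjm
  · rw [width_le_iff]
    intro Y hY
    obtain ⟨i, -, rfl⟩ := List.mem_map.1 hY
    exact h.card i
  · intro i h1 hi
    rw [List.length_map, List.length_range] at hi
    ext w
    rw [← List.map_take, List.take_range, min_eq_left hi]
    simp only [unionOf, prefixUnion, List.mem_map, List.mem_range, Set.mem_ofPred_eq]
    constructor
    · rintro ⟨_, ⟨j, hj, rfl⟩, hw⟩
      exact ⟨j, by omega, hw⟩
    · rintro ⟨j, hj, hw⟩
      exact ⟨_, ⟨j, by omega, rfl⟩, hw⟩

theorem hasRootedDecomposition_iff [Finite V] {I : Set V} {k : ℕ} :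
    HasRootedDecomposition G I ((k : ℤ) - 1) ↔ ∃ X, IsSeqDecomposition G I k Set.univ X := by
  refine ⟨fun h => h.exists_seq, ?_⟩
  rintro ⟨X, hX⟩
  obtain ⟨P, hP, hw, hu⟩ := exists_list_of_seq hX
  refine ⟨P, hP, ?_, hw⟩
  intro i h1 hi
  rw [hu i h1 hi]
  exact hX.rooted _

/-- A decomposition rooted at `v` can be chosen to start with the bag `{v}`. -/
theorem IsSeqDecomposition.exists_zero_eq_singleton [Finite V] {v : V} {k : ℕ} {X : ℕ → Set V}
    (h : IsSeqDecomposition G {v} k Set.univ X) :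
    ∃ Y, IsSeqDecomposition G {v} k Set.univ Y ∧ Y 0 = {v} := by
  classical
  have hex := h.covers v trivial
  set n := Nat.find hex with hn
  have hvn : v ∈ X n := Nat.find_spec hex
  -- A nonempty prefix must already contain `v`, so the bags before the first occurrence of `v` are
  -- empty and can be dropped.
  have hlt : ∀ i < n, X i = ∅ := by
    intro i hi
    by_contra hne
    obtain ⟨x, hx⟩ := Set.nonempty_iff_ne_empty.2 hne
    obtain ⟨⟨j, hj, hvj⟩, -⟩ := componentsMeet_singleton_iff.1 (h.rooted i) x ⟨i, le_rfl, hx⟩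
    exact Nat.find_min hex (by omega : j < n) hvj
  let Y : ℕ → Set V := fun i => if i = 0 then {v} else X (n + (i - 1))
  have hY0 : Y 0 = {v} := rfl
  have hYs : ∀ i, Y (i + 1) = X (n + i) := fun i => rfl
  have hmem : ∀ i w, w ∈ X i → ∃ j, n + j = i := by
    intro i w hw
    by_cases hi : i < n
    · rw [hlt i hi] at hw
      exact hw.elim
    · exact ⟨i - n, by omega⟩
  refine ⟨Y, ⟨fun _ => Set.subset_univ _, ?_, ?_, ?_, ?_, ?_⟩, hY0⟩
  · intro w _
    obtain ⟨i, hi⟩ := h.covers w trivial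
    obtain ⟨j, rfl⟩ := hmem i w hi
    exact ⟨j + 1, hi⟩
  · intro u _ w _ huw
    obtain ⟨i, hi⟩ := h.edges u trivial w trivial huw
    obtain ⟨j, rfl⟩ := hmem i u hi.1
    exact ⟨j + 1, hi⟩
  · rintro i j m hij hjm x ⟨hx1, hx2⟩
    rcases j with _ | j
    · obtain rfl : i = 0 := by omega
      exact hx1
    · rcases m with _ | m
      · omega
      · rw [hYs] at hx2 ⊢
        rcases i with _ | i
        · rw [hY0] at hx1
          obtain rfl : x = v := hx1
          exact h.interval n (n + j) (n + m) (by omega) (by omega) ⟨hvn, hx2⟩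
        · exact h.interval (n + i) (n + j) (n + m) (by omega) (by omega) ⟨hx1, hx2⟩
  · intro i
    rcases i with _ | i
    · rw [hY0, Set.ncard_singleton]
      have := (Set.ncard_pos (Set.toFinite (X n))).2 ⟨v, hvn⟩
      exact this.trans_le (h.card n)
    · exact h.card _
  · intro i
    rcases i with _ | i
    · rw [componentsMeet_singleton_iff]
      rintro x ⟨j, hj, hx⟩
      obtain rfl : j = 0 := by omega
      obtain rfl : x = v := hx
      exact ⟨⟨0, le_rfl, Set.mem_singleton x⟩, ReflTransGen.refl⟩
    · have : prefixUnion Y (i + 1) = prefixUnion X (n + i) := by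
        ext w
        constructor
        · rintro ⟨j, hj, hw⟩
          rcases j with _ | j
          · obtain rfl : w = v := hw
            exact ⟨n, by omega, hvn⟩
          · exact ⟨n + j, by omega, hw⟩
        · rintro ⟨j, hj, hw⟩
          obtain ⟨m, rfl⟩ := hmem j w hw
          exact ⟨m + 1, by omega, hw⟩
      rw [this]
      exact h.rooted _

/-! ### Partial decompositions with a prescribed last bag -/

theorem Conn.of_induce {H : Set V} {U : Set H} {x y : H} (h : Conn (G.induce H) U x y) :
    Conn G (Subtype.val '' U) x y := by
  induction h with
  | refl => exact ReflTransGen.refl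
  | @tail a b _ hab ih => exact ih.tail ⟨⟨a, hab.1, rfl⟩, ⟨b, hab.2.1, rfl⟩, hab.2.2⟩

/-- `G[C]` has an `I`-connected path decomposition with bags of size at most `k` whose last bag
is `B`. -/
def HasPartial (G : SimpleGraph V) (I : Set V) (k : ℕ) (C B : Set V) : Prop :=
  ∃ X n, IsSeqDecomposition G I k C X ∧ ∀ i, n ≤ i → X i = B

theorem hasPartial_singleton {I : Set V} {k : ℕ} {v : V} (hv : v ∈ I) (hk : 1 ≤ k) :
    HasPartial G I k {v} {v} := by
  refine ⟨fun _ => {v}, 0, ⟨fun _ => subset_rfl, fun _ hw => ⟨0, hw⟩,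
    fun _ hu _ hw _ => ⟨0, hu, hw⟩, fun _ _ _ _ _ _ hx => hx.1, ?_, ?_⟩, fun _ _ => rfl⟩
  · intro i
    rwa [Set.ncard_singleton]
  · intro i
    rw [componentsMeet_iff]
    rintro x ⟨j, hj, hx⟩
    have hxv : x = v := hx
    subst hxv
    exact ⟨x, ⟨j, hj, hx⟩, hv, ReflTransGen.refl⟩

theorem HasPartial.rooted {I : Set V} {k : ℕ} {C B : Set V} (h : HasPartial G I k C B) :
    ComponentsMeet G C I := by
  obtain ⟨X, n, h, hn⟩ := h
  have : prefixUnion X n = C := by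
    ext w
    constructor
    · rintro ⟨j, -, hw⟩
      exact h.subset j hw
    · intro hw
      obtain ⟨i, hi⟩ := h.covers w hw
      rcases le_total i n with hin | hin
      · exact ⟨i, hin, hi⟩
      · rw [hn i hin] at hi
        exact ⟨n, le_rfl, by rwa [hn n le_rfl]⟩
  rw [← this]
  exact h.rooted n

/-- Every edge between `C` and a new vertex lies in `Z` because `Z` contains the border of `C`. A
vertex of `Z` that is already in `C` lies in the last bag `B`, so its occurrences still form an
interval. -/
theorem HasPartial.extend {I : Set V} {k : ℕ} {C B Z : Set V} (h : HasPartial G I k C B)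
    (hborder : ∀ p ∈ C, ∀ q ∉ C, G.Adj p q → p ∈ Z) (hZ : Z ∩ C ⊆ B) (hcard : Z.ncard ≤ k)
    (hroot : ComponentsMeet G (C ∪ Z) I) : HasPartial G I k (C ∪ Z) Z := by
  obtain ⟨X, n, h, hn⟩ := h
  let Y : ℕ → Set V := fun i => if i ≤ n then X i else Z
  have hYle : ∀ i, i ≤ n → Y i = X i := fun i hi => if_pos hi
  have hYgt : ∀ i, n < i → Y i = Z := fun i hi => if_neg (not_le.2 hi)
  -- All bags of `X` from index `n` on equal `B`, so cutting `X` off after index `n` loses nothing.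
  have hmin : ∀ i, X i ⊆ Y (min i n) := by
    intro i
    rw [hYle _ (min_le_right _ _)]
    rcases le_total i n with hi | hi
    · rw [min_eq_left hi]
    · rw [min_eq_right hi, hn i hi, hn n le_rfl]
  have hlast : ∀ x ∈ Z, x ∈ Y (n + 1) := fun x hx => by rwa [hYgt _ (Nat.lt_succ_self n)]
  refine ⟨Y, n + 1, ⟨?_, ?_, ?_, ?_, ?_, ?_⟩, fun i hi => hYgt i hi⟩
  · intro i
    rcases le_or_gt i n with hi | hi
    · rw [hYle i hi]
      exact (h.subset i).trans Set.subset_union_left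
    · rw [hYgt i hi]
      exact Set.subset_union_right
  · rintro w (hw | hw)
    · obtain ⟨i, hi⟩ := h.covers w hw
      exact ⟨_, hmin i hi⟩
    · exact ⟨n + 1, hlast w hw⟩
  · intro u hu w hw huw
    by_cases huC : u ∈ C <;> by_cases hwC : w ∈ C
    · obtain ⟨i, h1, h2⟩ := h.edges u huC w hwC huw
      exact ⟨_, hmin i h1, hmin i h2⟩
    · exact ⟨n + 1, hlast u (hborder u huC w hwC huw), hlast w (hw.resolve_left hwC)⟩
    · exact ⟨n + 1, hlast u (hu.resolve_left huC), hlast w (hborder w hwC u huC huw.symm)⟩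
    · exact ⟨n + 1, hlast u (hu.resolve_left huC), hlast w (hw.resolve_left hwC)⟩
  · rintro i j m hij hjm x ⟨hi, hm⟩
    rcases le_or_gt m n with hmn | hmn
    · rw [hYle _ (by omega)] at hi hm ⊢
      exact h.interval i j m hij hjm ⟨hi, hm⟩
    · rcases le_or_gt j n with hjn | hjn
      · rw [hYle _ (by omega)] at hi ⊢
        rw [hYgt m hmn] at hm
        refine h.interval i j n hij hjn ⟨hi, ?_⟩
        rw [hn n le_rfl]
        exact hZ ⟨hm, h.subset i hi⟩
      · rw [hYgt m hmn] at hm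
        rwa [hYgt j hjn]
  · intro i
    rcases le_or_gt i n with hi | hi
    · rw [hYle i hi]
      exact h.card i
    · rwa [hYgt i hi]
  · intro i
    rcases le_or_gt i n with hi | hi
    · have : prefixUnion Y i = prefixUnion X i := by
        ext w
        refine exists_congr fun j => and_congr_right fun hj => ?_
        rw [hYle j (hj.trans hi)]
      rw [this]
      exact h.rooted i
    · have : prefixUnion Y i = C ∪ Z := by
        ext w
        constructor
        · rintro ⟨j, -, hw⟩
          rcases le_or_gt j n with hj | hj
          · rw [hYle j hj] at hw
            exact Or.inl (h.subset j hw)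
          · rw [hYgt j hj] at hw
            exact Or.inr hw
        · rintro (hw | hw)
          · obtain ⟨j, hj⟩ := h.covers w hw
            exact ⟨_, (min_le_right j n).trans hi.le, hmin j hj⟩
          · exact ⟨n + 1, hi, hlast w hw⟩
      rw [this]
      exact hroot

theorem ComponentsMeet.union_of_adj {I C Z : Set V} (hC : ComponentsMeet G C I)
    (hZ : ∀ x ∈ Z, ∃ y ∈ Z, Conn G Z x y ∧ ∃ u ∈ C, G.Adj y u) :
    ComponentsMeet G (C ∪ Z) I := by
  rw [componentsMeet_iff] at hC ⊢
  have key : ∀ x ∈ C, ∃ y ∈ C ∪ Z, y ∈ I ∧ Conn G (C ∪ Z) x y := by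
    intro x hx
    obtain ⟨y, hy, hyI, hc⟩ := hC x hx
    exact ⟨y, Or.inl hy, hyI, hc.mono Set.subset_union_left⟩
  rintro x (hx | hx)
  · exact key x hx
  · obtain ⟨y, hy, hc, u, hu, hyu⟩ := hZ x hx
    obtain ⟨z, hz, hzI, hcz⟩ := key u hu
    refine ⟨z, hz, hzI, (hc.mono Set.subset_union_right).trans (ReflTransGen.head ?_ hcz)⟩
    exact ⟨Or.inr hy, Or.inl hu, hyu⟩

/-- A whole branch with a rooted decomposition can be appended to a partial decomposition whose
last bag contains the attachment set of the branch. -/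
theorem HasPartial.append_branch [Finite V] {I : Set V} {k j : ℕ} {C B H S : Set V}
    (h : HasPartial G I k C B) (hBC : B ⊆ C) (hborder : ∀ p ∈ C, ∀ q ∉ C, G.Adj p q → p ∈ B)
    (hS : nbhd G H = S) (hH : S ⊆ B) (hB : B.ncard + j ≤ k) {Y : ℕ → Set H}
    (hY : IsSeqDecomposition (G.induce H) {v | (v : V) ∈ nbhd G S} j Set.univ Y) :
    HasPartial G I k (C ∪ H) B := by
  subst hS
  let y : ℕ → Set V := fun i => Subtype.val '' Y i
  have hyH : ∀ i, y i ⊆ H := by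
    rintro i _ ⟨x, -, rfl⟩
    exact x.2
  have hpre : ∀ i, prefixUnion y i = Subtype.val '' prefixUnion Y i := by
    intro i
    ext w
    constructor
    · rintro ⟨m, hm, x, hx, rfl⟩
      exact ⟨x, ⟨m, hm, hx⟩, rfl⟩
    · rintro ⟨x, ⟨m, hm, hx⟩, rfl⟩
      exact ⟨m, hm, x, hx, rfl⟩
  have hpreH : ∀ i, prefixUnion y i ⊆ H := fun i w ⟨m, _, hw⟩ => hyH m hw
  have hroot : ∀ i, ComponentsMeet G (C ∪ prefixUnion y i) I := by
    intro i
    refine h.rooted.union_of_adj ?_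
    rw [hpre]
    rintro _ ⟨x, hx, rfl⟩
    obtain ⟨z, hz, hzN, hc⟩ := componentsMeet_iff.1 (hY.rooted i) x hx
    obtain ⟨-, u, hu, huz⟩ := hzN
    exact ⟨z, ⟨z, hz, rfl⟩, hc.of_induce, u, hBC (hH hu), huz.symm⟩
  -- The new bags are `B ∪ y i \ C`. Vertices of `C` are removed because `H` may overlap `C`, and a
  -- covered vertex outside the current bag must not reappear.
  have hcard : ∀ i, (B ∪ y i \ C).ncard ≤ k := by
    intro i
    have h1 := Set.ncard_union_le B (y i \ C)
    have h2 : (y i \ C).ncard ≤ (y i).ncard := Set.ncard_le_ncard Set.sdiff_subset (Set.toFinite _)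
    have h3 : (y i).ncard = (Y i).ncard :=
      Set.ncard_image_of_injective _ Subtype.val_injective
    have h4 := hY.card i
    omega
  have hstay : ∀ i, ∀ p ∈ H, ∀ q ∉ C ∪ prefixUnion y i, G.Adj p q → q ∈ H := by
    intro i p hp q hq hpq
    by_contra hqH
    exact hq (Or.inl (hBC (hH ⟨hqH, p, hp, hpq⟩)))
  have hlater : ∀ i, ∀ p ∈ prefixUnion y i, ∀ q ∉ C ∪ prefixUnion y i, G.Adj p q →
      p ∈ y (i + 1) := by
    intro i p hp q hq hpq
    have hqH := hstay i p (hpreH i hp) q hq hpq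
    obtain ⟨m, hm1, hm2⟩ := hY.edges ⟨p, hpreH i hp⟩ trivial ⟨q, hqH⟩ trivial hpq
    have him : i + 1 ≤ m := by
      by_contra hmi
      exact hq (Or.inr ⟨m, by omega, _, hm2, rfl⟩)
    obtain ⟨n, hn, x, hx, rfl⟩ := hp
    exact ⟨x, hY.interval n (i + 1) m (by omega) him ⟨hx, hm1⟩, rfl⟩
  have hmain : ∀ i, HasPartial G I k (C ∪ prefixUnion y i) (B ∪ y i \ C) := by
    intro i
    induction i with
    | zero =>
      have h0 : prefixUnion y 0 = y 0 := by
        ext w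
        exact ⟨fun ⟨m, hm, hw⟩ => by rwa [Nat.le_zero.1 hm] at hw, fun hw => ⟨0, le_rfl, hw⟩⟩
      have hCu : C ∪ prefixUnion y 0 = C ∪ (B ∪ y 0 \ C) := by
        rw [h0, ← Set.union_assoc, Set.union_eq_left.2 hBC, Set.union_sdiff_self]
      rw [hCu]
      refine h.extend (fun p hp q hq hpq => Or.inl (hborder p hp q hq hpq)) ?_ (hcard 0) ?_
      · rintro x ⟨hx | hx, hxC⟩
        · exact hx
        · exact absurd hxC hx.2
      · rw [← hCu]
        exact hroot 0
    | succ i ih =>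
      have hCu : C ∪ prefixUnion y (i + 1) = (C ∪ prefixUnion y i) ∪ (B ∪ y (i + 1) \ C) := by
        ext w
        constructor
        · rintro (hw | ⟨m, hm, hw⟩)
          · exact Or.inl (Or.inl hw)
          · by_cases hwC : w ∈ C
            · exact Or.inl (Or.inl hwC)
            · rcases Nat.le_succ_iff.1 hm with hm | rfl
              · exact Or.inl (Or.inr ⟨m, hm, hw⟩)
              · exact Or.inr (Or.inr ⟨hw, hwC⟩)
        · rintro ((hw | ⟨m, hm, hw⟩) | hw | hw)
          · exact Or.inl hw
          · exact Or.inr ⟨m, by omega, hw⟩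
          · exact Or.inl (hBC hw)
          · exact Or.inr ⟨i + 1, le_rfl, hw.1⟩
      rw [hCu]
      refine ih.extend ?_ ?_ (hcard _) ?_
      · intro p hp q hq hpq
        by_cases hpC : p ∈ C
        · exact Or.inl (hborder p hpC q (fun hqC => hq (Or.inl hqC)) hpq)
        · exact Or.inr ⟨hlater i p (hp.resolve_left hpC) q hq hpq, hpC⟩
      · rintro x ⟨hx | hx, hxC⟩
        · exact Or.inl hx
        · obtain ⟨n, hn, z, hz, hzx⟩ := hxC.resolve_left hx.2
          obtain ⟨⟨z', hz', hzx'⟩, hxC'⟩ := hx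
          obtain rfl : z = z' := Subtype.val_injective (hzx.trans hzx'.symm)
          exact Or.inr ⟨⟨z, hY.interval n i (i + 1) hn (Nat.le_succ i) ⟨hz, hz'⟩, hzx⟩, hxC'⟩
      · rw [← hCu]
        exact hroot _
  have hall : ∃ n, prefixUnion y n = H := by
    choose a ha using fun w : H => hY.covers w trivial
    obtain ⟨n, hn⟩ := (Set.finite_range a).bddAbove
    refine ⟨n, (hpreH n).antisymm fun w hw => ?_⟩
    exact ⟨a ⟨w, hw⟩, hn ⟨_, rfl⟩, ⟨w, hw⟩, ha _, rfl⟩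
  obtain ⟨n, hn⟩ := hall
  have hfin := hmain n
  rw [hn] at hfin
  -- One more bag `B` restores the prescribed last bag, ready for the next branch.
  have hCu : C ∪ H = (C ∪ H) ∪ B :=
    (Set.union_eq_left.2 (hBC.trans Set.subset_union_left)).symm
  rw [hCu]
  refine hfin.extend ?_ (fun x hx => Or.inl hx.1) (by omega) ?_
  · rintro p (hp | hp) q hq hpq
    · exact hborder p hp q (fun hqC => hq (Or.inl hqC)) hpq
    · exact absurd (hBC (hH ⟨fun hqH => hq (Or.inr hqH), p, hp, hpq⟩))
        (fun hqC => hq (Or.inl hqC))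
  · rw [← hCu]
    exact hfin.rooted

/-! ### Soundness of the two extensions -/

theorem PotentialState.bag_subset_cover {k : ℕ} (s : PotentialState G k) : s.bag ⊆ s.cover :=
  Set.subset_union_left

theorem PotentialState.mem_bag_of_adj {k : ℕ} (s : PotentialState G k) {p q : V}
    (hp : p ∈ s.cover) (hq : q ∉ s.cover) (hpq : G.Adj p q) : p ∈ s.bag := by
  rcases hp with hp | ⟨S, hne, hS, H, hf, hp⟩
  · exact hp
  · refine absurd ?_ hq
    by_cases hqH : q ∈ (H : Set V)
    · exact Or.inr ⟨S, hne, hS, H, hf, hqH⟩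
    · have hqN : q ∈ nbhd G (H : Set V) := ⟨hqH, p, hp, hpq⟩
      rw [H.2.2] at hqN
      exact s.bag_subset_cover (hS hqN)

theorem StepExt.hasPartial {k : ℕ} {I : Set V} {w s : State G k I} (h : StepExt w s)
    (hw : HasPartial G I k w.cover w.bag) : HasPartial G I k s.cover s.bag := by
  have hr := s.rooted
  rw [h.cover] at hr ⊢
  exact hw.extend (fun p hp q hq hpq => h.border ⟨hp, q, hq, hpq⟩) h.bag s.bag_card hr

theorem JumpExt.cover_eq {k : ℕ} {I : Set V} {w s : State G k I} (hbag : w.bag = s.bag)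
    {S' : Set V} {hne : S'.Nonempty} {hw : S' ⊆ w.bag} {hs : S' ⊆ s.bag}
    (h1 : ∀ H ∉ w.B S' hne hw, w.f S' hne hw H = false ∧ s.f S' hne hs H = true)
    (h2 : ∀ H ∈ w.B S' hne hw, w.f S' hne hw H = s.f S' hne hs H)
    (h3 : ∀ S hSne hSw hSs, S ≠ S' → ∀ H, w.f S hSne hSw H = s.f S hSne hSs H) :
    s.cover = w.cover ∪ {v | ∃ H ∉ w.B S' hne hw, v ∈ (H : Set V)} := by
  ext v
  constructor
  · rintro (hv | ⟨S, hSne, hS, H, hf, hv⟩)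
    · exact Or.inl (Or.inl (hbag ▸ hv))
    · have hSw : S ⊆ w.bag := hbag ▸ hS
      by_cases hSS : S = S'
      · subst hSS
        by_cases hB : H ∈ w.B S hne hw
        · exact Or.inl (Or.inr ⟨S, hSne, hSw, H, (h2 H hB).trans hf, hv⟩)
        · exact Or.inr ⟨H, hB, hv⟩
      · exact Or.inl (Or.inr ⟨S, hSne, hSw, H, (h3 S hSne hSw hS hSS H).trans hf, hv⟩)
  · rintro ((hv | ⟨S, hSne, hS, H, hf, hv⟩) | ⟨H, hB, hv⟩)
    · exact Or.inl (hbag ▸ hv)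
    · have hSs : S ⊆ s.bag := hbag ▸ hS
      by_cases hSS : S = S'
      · subst hSS
        by_cases hB : H ∈ w.B S hne hw
        · exact Or.inr ⟨S, hSne, hSs, H, (h2 H hB).symm.trans hf, hv⟩
        · exact Or.inr ⟨S, hne, hs, H, (h1 H hB).2, hv⟩
      · exact Or.inr ⟨S, hSne, hSs, H, (h3 S hSne hS hSs hSS H).symm.trans hf, hv⟩
    · exact Or.inr ⟨S', hne, hs, H, (h1 H hB).2, hv⟩

/-- The branches are appended one at a time. The bag keeps containing the border, since the
neighbours of a finished branch lie in it or in the bottleneck, hence in the cover. -/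
theorem JumpExt.hasPartial [Finite V] {k : ℕ} {I : Set V} {w s : State G k I} (h : JumpExt w s)
    (hP : HasPartial G I k w.cover w.bag) : HasPartial G I k s.cover s.bag := by
  obtain ⟨hbag, -, S', hne, hw, hs, -, h1, h2, h3, h4⟩ := h
  rw [JumpExt.cover_eq hbag h1 h2 h3, ← hbag]
  have hk := w.bag_card
  have key : ∀ F : Set (branches G S'), F.Finite → (∀ H ∈ F, H ∉ w.B S' hne hw) →
      HasPartial G I k (w.cover ∪ {v | ∃ H ∈ F, v ∈ (H : Set V)}) w.bag := by
    intro F hF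
    induction F, hF using Set.Finite.induction_on with
    | empty =>
      intro _
      convert hP using 1
      ext v
      simp
    | @insert H F _ _ ih =>
      intro hsub
      have hF := ih fun K hK => hsub K (Or.inr hK)
      have hd := h4 H (hsub H (Or.inl rfl))
      have hcast : (k : ℤ) - w.bag.ncard - 1 = ((k - w.bag.ncard : ℕ) : ℤ) - 1 := by
        rw [Nat.cast_sub hk]
      have hHS : nbhd G (H : Set V) = S' := H.2.2
      rw [hcast, hasRootedDecomposition_iff] at hd
      obtain ⟨Y, hY⟩ := hd
      have := hF.append_branch (w.bag_subset_cover.trans Set.subset_union_left) ?_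
        hHS hw (by omega : w.bag.ncard + (k - w.bag.ncard) ≤ k) hY
      · convert this using 1
        ext v
        simp only [Set.mem_union, Set.mem_ofPred_eq, Set.mem_insert_iff, exists_eq_or_imp]
        exact (or_congr_right or_comm).trans or_assoc.symm
      · rintro p (hp | ⟨K, hK, hp⟩) q hq hpq
        · exact w.mem_bag_of_adj hp (fun hqC => hq (Or.inl hqC)) hpq
        · refine absurd ?_ hq
          by_cases hqK : q ∈ (K : Set V)
          · exact Or.inr ⟨K, hK, hqK⟩
          · have hqN : q ∈ nbhd G (K : Set V) := ⟨hqK, p, hp, hpq⟩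
            rw [K.2.2] at hqN
            exact Or.inl (w.bag_subset_cover (hw hqN))
  exact key _ (Set.toFinite (w.B S' hne hw)ᶜ) fun H hH => hH

/-! ### Invariants and closure of the table -/

/-- A property that holds for the initial entries and is preserved by both extensions holds for
all true entries of the table. -/
theorem Tab.induction {k : ℕ} {I : Set V} {ord : ProcessingOrder G k I} {P : State G k I → Prop}
    (hinit : ∀ s, initTab s → P s) (hext : ∀ w s, StepExt w s ∨ JumpExt w s → P w → P s)
    {s : State G k I} (h : Tab ord s) : P s := by
  have key : ∀ (l : List (State G k I)) (T : State G k I → Prop), (∀ t, T t → P t) →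
      ∀ t, l.foldl (process ord) T t → P t := by
    intro l
    induction l with
    | nil => exact fun T hT => hT
    | cons a l ih =>
      intro T hT
      refine ih _ ?_
      rintro t (ht | ⟨rfl, -, w, -, -, hw, he⟩)
      · exact hT t ht
      · exact hext w t he (hT w hw)
  exact key _ _ hinit s h

theorem foldl_process_mono {k : ℕ} {I : Set V} (ord : ProcessingOrder G k I)
    (l : List (State G k I)) {T : State G k I → Prop} {t : State G k I} (h : T t) :
    l.foldl (process ord) T t := by
  induction l generalizing T with
  | nil => exact h
  | cons a l ih => exact ih (Or.inl h)

theorem foldl_process_of_notMem {k : ℕ} {I : Set V} (ord : ProcessingOrder G k I)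
    (l : List (State G k I)) {T : State G k I → Prop} {t : State G k I} (ht : t ∉ l)
    (h : l.foldl (process ord) T t) : T t := by
  induction l generalizing T with
  | nil => exact h
  | cons a l ih =>
    rw [List.mem_cons, not_or] at ht
    exact (ih ht.2 h).resolve_right fun h' => ht.1 h'.1

theorem Tab.of_init {k : ℕ} {I : Set V} (ord : ProcessingOrder G k I) {s : State G k I}
    (h : initTab s) : Tab ord s :=
  foldl_process_mono ord _ h

theorem Tab.of_prec {k : ℕ} {I : Set V} {ord : ProcessingOrder G k I} {w s : State G k I}
    (hw : Tab ord w) (hs : 1 < s.cover.ncard) (hprec : ord.prec w s)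
    (hd : Distinguishable w s) (he : StepExt w s ∨ JumpExt w s) : Tab ord s := by
  have := ord.strictTotal
  obtain ⟨l₁, l₂, hl⟩ := List.append_of_mem (ord.complete s)
  have hsort := ord.sorted
  unfold Tab at hw ⊢
  rw [hl] at hsort hw ⊢
  rw [List.foldl_append] at hw ⊢
  -- The entry of `w` can only change when `w` is processed, which is before `s`; so it already has
  -- its final value when `s` is reached.
  have hnot : w ∉ s :: l₂ := by
    intro hmem
    rcases List.mem_cons.1 hmem with rfl | hmem
    · exact irrefl_of ord.prec _ hprec
    · have := (List.pairwise_cons.1 (List.pairwise_append.1 hsort).2.1).1 w hmem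
      exact irrefl_of ord.prec _ (trans_of ord.prec hprec this)
  have hw' := foldl_process_of_notMem ord _ hnot hw
  exact foldl_process_mono ord l₂ (Or.inr ⟨rfl, hs, w, hprec, hd, hw', he⟩)

/-- The processing order is compatible with the two extensions, so that the table is closed under
them. -/
theorem Tab.of_ext [Finite V] {k : ℕ} {I : Set V} {ord : ProcessingOrder G k I}
    {w s : State G k I} (hw : Tab ord w) (hsub : w.cover ⊆ s.cover) (hd : Distinguishable w s)
    (hbag : w.cover = s.cover → s.bag ⊆ w.bag) (he : StepExt w s ∨ JumpExt w s) :
    Tab ord s := by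
  have hwc : 0 < w.bag.ncard := (Set.ncard_pos (Set.toFinite _)).2 w.bag_nonempty
  have hwb : w.bag.ncard ≤ w.cover.ncard := Set.ncard_le_ncard w.bag_subset_cover (Set.toFinite _)
  by_cases hc : w.cover = s.cover
  · have hlt : s.bag.ncard < w.bag.ncard :=
      Set.ncard_lt_ncard ((hbag hc).ssubset_of_ne fun h => hd ⟨hc, h.symm⟩) (Set.toFinite _)
    have hsc : 0 < s.bag.ncard := (Set.ncard_pos (Set.toFinite _)).2 s.bag_nonempty
    exact hw.of_prec (by rw [← hc]; omega) (ord.prec_of_bag w s (by rw [hc]) hlt) hd he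
  · have hlt : w.cover.ncard < s.cover.ncard :=
      Set.ncard_lt_ncard (hsub.ssubset_of_ne hc) (Set.toFinite _)
    exact hw.of_prec (by omega) (ord.prec_of_cover w s hlt) hd he

theorem Tab.hasPartial [Finite V] {k : ℕ} {I : Set V} {ord : ProcessingOrder G k I}
    {s : State G k I} (h : Tab ord s) : HasPartial G I k s.cover s.bag := by
  refine Tab.induction (P := fun s => HasPartial G I k s.cover s.bag) ?_ ?_ h
  · rintro s ⟨v, hv, hc, hb⟩
    have hk := s.bag_card
    rw [hb, Set.ncard_singleton] at hk
    rw [hc, hb]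
    exact hasPartial_singleton hv hk
  · rintro w s (he | he) hw
    · exact he.hasPartial hw
    · exact he.hasPartial hw

theorem Tab.hasRootedDecomposition [Finite V] {k : ℕ} {I : Set V} {ord : ProcessingOrder G k I}
    {s : State G k I} (h : Tab ord s) (hs : s.cover = Set.univ) :
    HasRootedDecomposition G I ((k : ℤ) - 1) := by
  obtain ⟨X, -, hX, -⟩ := h.hasPartial
  rw [hs] at hX
  exact hasRootedDecomposition_iff.2 ⟨X, hX⟩

/-! ### Inner branches of a decomposition -/

/-- A connected set that meets a bag before `m` and a bag after `m` meets the bag `m`. -/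
theorem IsSeqDecomposition.inter_nonempty_of_connSet {I : Set V} {k : ℕ} {X : ℕ → Set V}
    (h : IsSeqDecomposition G I k Set.univ X) {H : Set V} (hH : ConnSet G H) {i m j : ℕ}
    (him : i ≤ m) (hmj : m ≤ j) (hi : (X i ∩ H).Nonempty) (hj : (X j ∩ H).Nonempty) :
    (X m ∩ H).Nonempty := by
  obtain ⟨x, hxi, hxH⟩ := hi
  obtain ⟨y, hyj, hyH⟩ := hj
  by_cases hyA : y ∈ prefixUnion X m
  · obtain ⟨n, hn, hyn⟩ := hyA
    exact ⟨y, h.interval n m j hn hmj ⟨hyn, hyj⟩, hyH⟩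
  · obtain ⟨a, b, -, -, haA, hbH, ⟨n, hn, hbn⟩, hab⟩ :=
      (hH y hyH x hxH).exists_crossing hyH hyA ⟨i, him, hxi⟩
    obtain ⟨l, hal, hbl⟩ := h.edges a trivial b trivial hab
    have hml : m ≤ l := by
      by_contra hlt
      exact haA ⟨l, by omega, hal⟩
    exact ⟨b, h.interval n m l hn hml ⟨hbn, hbl⟩, hbH⟩

theorem IsSeqDecomposition.exists_bag_of_mem_nbhd {I : Set V} {k : ℕ} {X : ℕ → Set V}
    (h : IsSeqDecomposition G I k Set.univ X) {H : Set V} {s : V} (hs : s ∈ nbhd G H) :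
    ∃ i, s ∈ X i ∧ (X i ∩ H).Nonempty := by
  obtain ⟨-, u, hu, hus⟩ := hs
  obtain ⟨i, h1, h2⟩ := h.edges u trivial s trivial hus
  exact ⟨i, h2, u, h1, hu⟩

/-- `H` is a branch of the bottleneck `S` all of whose bags lie strictly between bags containing
any given vertex of `S`. -/
structure IsInner (G : SimpleGraph V) (k : ℕ) (X : ℕ → Set V) (S H : Set V) : Prop where
  bottleneck : IsBottleneck G k S
  branch : H ∈ branches G S
  before : ∀ j, (X j ∩ H).Nonempty → ∀ s ∈ S, ∃ a < j, s ∈ X a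
  after : ∀ j, (X j ∩ H).Nonempty → ∀ s ∈ S, ∃ b, j < b ∧ s ∈ X b

/-- The union of the inner branches. -/
def innerUnion (G : SimpleGraph V) (k : ℕ) (X : ℕ → Set V) : Set V :=
  {w | ∃ S H, IsInner G k X S H ∧ w ∈ H}

/-- A bottleneck outside all inner branches. -/
def IsTop (G : SimpleGraph V) (k : ℕ) (X : ℕ → Set V) (S : Set V) : Prop :=
  IsBottleneck G k S ∧ Disjoint S (innerUnion G k X)

theorem eq_of_branches_inter_nonempty {S H K : Set V} (hH : H ∈ branches G S)
    (hK : K ∈ branches G S) (h : (H ∩ K).Nonempty) : H = K := by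
  obtain ⟨-, hHc, hHS⟩ := mem_branches_iff.1 hH
  obtain ⟨-, hKc, hKS⟩ := mem_branches_iff.1 hK
  refine (hHc.subset_of_disjoint_nbhd ?_ h).antisymm
    (hKc.subset_of_disjoint_nbhd ?_ (by rwa [Set.inter_comm]))
  · rw [hKS, ← hHS]
    exact Set.disjoint_left.2 fun x hx => hx.1
  · rw [hHS, ← hKS]
    exact Set.disjoint_left.2 fun x hx => hx.1

/-- A branch violating `before` meets a fixed bag `X M`, and one violating `after` meets a fixed bag
`X m`. Distinct branches of `S` are disjoint, so there are at most `|X M| + |X m| ≤ 2k` of them. -/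
theorem IsSeqDecomposition.ncard_not_inner_le [Finite V] {I : Set V} {k : ℕ} {X : ℕ → Set V}
    (h : IsSeqDecomposition G I k Set.univ X) {S : Set V} (hne : S.Nonempty) :
    {H : branches G S | ¬ IsInner G k X S H}.ncard ≤ 2 * k := by
  classical
  by_cases hb : IsBottleneck G k S
  swap
  · have h1 : (branches G S).ncard ≤ 2 * k := by
      by_contra hlt
      exact hb ⟨hne, by omega⟩
    refine le_trans ?_ h1
    rw [← Set.ncard_image_of_injective _ Subtype.val_injective]
    refine Set.ncard_le_ncard ?_ (Set.toFinite _)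
    rintro _ ⟨x, -, rfl⟩
    exact x.2
  -- Take `t ∈ S` whose first occurrence `M` is latest. The violating branch is hit no later than
  -- `M`, and shares a bag with its neighbour `t` no earlier than `M`, so it meets `X M`.
  have hM : ∃ M, ∀ H ∈ branches G S,
      (∃ j, (X j ∩ H).Nonempty ∧ ∃ s ∈ S, ∀ a < j, s ∉ X a) → (X M ∩ H).Nonempty := by
    have hf : ∀ s : V, ∃ i, s ∈ X i := fun s => h.covers s trivial
    obtain ⟨t, htS, ht⟩ := Set.exists_max_image S (fun s => Nat.find (hf s)) (Set.toFinite S) hne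
    refine ⟨Nat.find (hf t), ?_⟩
    rintro H hH ⟨j, hj, s, hs, hsj⟩
    obtain ⟨-, hHc, rfl⟩ := mem_branches_iff.1 hH
    obtain ⟨i, hti, hi⟩ := h.exists_bag_of_mem_nbhd htS
    refine h.inter_nonempty_of_connSet hHc (le_trans ?_ (ht s hs)) (Nat.find_min' _ hti) hj hi
    exact (Nat.le_find_iff _ _).2 hsj
  -- Symmetrically, `m` is the least index after which some vertex of `S` no longer occurs; if there
  -- is none, any index will do.
  have hm : ∃ m, ∀ H ∈ branches G S,
      (∃ j, (X j ∩ H).Nonempty ∧ ∃ s ∈ S, ∀ b, j < b → s ∉ X b) → (X m ∩ H).Nonempty := by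
    by_cases hex : ∃ j, ∃ s ∈ S, ∀ b, j < b → s ∉ X b
    · refine ⟨Nat.find hex, ?_⟩
      obtain ⟨t, htS, ht⟩ := Nat.find_spec hex
      rintro H hH ⟨j, hj, s, hs, hsj⟩
      obtain ⟨-, hHc, rfl⟩ := mem_branches_iff.1 hH
      obtain ⟨i, hti, hi⟩ := h.exists_bag_of_mem_nbhd htS
      have hle : i ≤ Nat.find hex := by
        by_contra hlt
        exact ht i (by omega) hti
      exact h.inter_nonempty_of_connSet hHc hle (Nat.find_min' hex ⟨s, hs, hsj⟩) hi hj
    · refine ⟨0, ?_⟩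
      rintro H - ⟨j, -, s, hs, hsj⟩
      exact absurd ⟨j, s, hs, hsj⟩ hex
  obtain ⟨M, hM⟩ := hM
  obtain ⟨m, hm⟩ := hm
  have hmeet : ∀ H : branches G S, ¬ IsInner G k X S H → ∃ x, x ∈ X M ∪ X m ∧ x ∈ (H : Set V) := by
    intro H hH
    by_contra hcon
    push Not at hcon
    refine hH ⟨hb, H.2, ?_, ?_⟩
    · intro j hj s hs
      by_contra hno
      push Not at hno
      obtain ⟨x, hx, hxH⟩ := hM H H.2 ⟨j, hj, s, hs, hno⟩
      exact hcon x (Or.inl hx) hxH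
    · intro j hj s hs
      by_contra hno
      push Not at hno
      obtain ⟨x, hx, hxH⟩ := hm H H.2 ⟨j, hj, s, hs, hno⟩
      exact hcon x (Or.inr hx) hxH
  have : Nonempty V := ⟨hne.some⟩
  choose! g hg1 hg2 using hmeet
  have hinj : {H : branches G S | ¬ IsInner G k X S H}.ncard ≤ (X M ∪ X m).ncard := by
    refine Set.ncard_le_ncard_of_injOn g hg1 ?_ (Set.toFinite _)
    intro H hH K hK hHK
    refine Subtype.ext (eq_of_branches_inter_nonempty H.2 K.2 ⟨g H, hg2 H hH, ?_⟩)
    rw [hHK]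
    exact hg2 K hK
  have h1 := Set.ncard_union_le (X M) (X m)
  have h2 := h.card M
  have h3 := h.card m
  omega

namespace IsInner

variable {k : ℕ} {X : ℕ → Set V} {S S' H H' : Set V}

theorem nonempty (h : IsInner G k X S H) : H.Nonempty := (mem_branches_iff.1 h.branch).1

theorem connSet (h : IsInner G k X S H) : ConnSet G H := (mem_branches_iff.1 h.branch).2.1

theorem nbhd_eq (h : IsInner G k X S H) : nbhd G H = S := h.branch.2

theorem subset_innerUnion (h : IsInner G k X S H) : H ⊆ innerUnion G k X :=
  fun _ hw => ⟨S, H, h, hw⟩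

theorem mem_or_mem_of_adj (h : IsInner G k X S H) {p q : V} (hp : p ∈ H) (hpq : G.Adj p q) :
    q ∈ H ∨ q ∈ S := by
  by_cases hq : q ∈ H
  · exact Or.inl hq
  · right
    rw [← h.nbhd_eq]
    exact ⟨hq, p, hp, hpq⟩

theorem subset_bag {I : Set V} (hX : IsSeqDecomposition G I k Set.univ X)
    (h : IsInner G k X S H) {j : ℕ} (hj : (X j ∩ H).Nonempty) : S ⊆ X j := by
  intro s hs
  obtain ⟨a, ha, hsa⟩ := h.before j hj s hs
  obtain ⟨b, hb, hsb⟩ := h.after j hj s hs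
  exact hX.interval a j b ha.le hb.le ⟨hsa, hsb⟩

theorem exists_hit {I : Set V} (hX : IsSeqDecomposition G I k Set.univ X)
    (h : IsInner G k X S H) : ∃ j, (X j ∩ H).Nonempty := by
  obtain ⟨x, hx⟩ := h.nonempty
  obtain ⟨j, hj⟩ := hX.covers x trivial
  exact ⟨j, x, hj, hx⟩

/-- Two inner branches cannot both contain a vertex of the attachment set of the other. -/
theorem disjoint_or_disjoint {I : Set V} (hX : IsSeqDecomposition G I k Set.univ X)
    (h : IsInner G k X S H) (h' : IsInner G k X S' H') : Disjoint S H' ∨ Disjoint S' H := by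
  classical
  by_contra hcon
  rw [not_or, Set.not_disjoint_iff, Set.not_disjoint_iff] at hcon
  obtain ⟨⟨s, hs, hsH⟩, s', hs', hsH'⟩ := hcon
  have e := h.exists_hit hX
  have e' := h'.exists_hit hX
  -- Before `H` is first hit, a bag contains `s ∈ H'`; so `H'` is hit strictly earlier than `H`, and
  -- by symmetry `H` strictly earlier than `H'`.
  obtain ⟨a, ha, hsa⟩ := h.before _ (Nat.find_spec e) s hs
  obtain ⟨a', ha', hsa'⟩ := h'.before _ (Nat.find_spec e') s' hs'
  have h1 := Nat.find_min' e' ⟨s, hsa, hsH⟩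
  have h2 := Nat.find_min' e ⟨s', hsa', hsH'⟩
  omega

theorem root_notMem {v : V} (hX0 : X 0 = {v}) (h : IsInner G k X S H) : v ∉ H := by
  intro hv
  obtain ⟨s, hs⟩ := h.bottleneck.1
  obtain ⟨a, ha, -⟩ := h.before 0 ⟨v, by rw [hX0]; rfl, hv⟩ s hs
  omega

theorem eq_of_inter_nonempty (h : IsInner G k X S H) (h' : IsInner G k X S' H')
    (hS : IsTop G k X S) (hS' : IsTop G k X S') (hm : (H ∩ H').Nonempty) : S = S' := by
  have h1 : H ⊆ H' := h.connSet.subset_of_disjoint_nbhd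
    (by rw [h'.nbhd_eq]; exact hS'.2.mono_right h.subset_innerUnion) hm
  have h2 : H' ⊆ H := h'.connSet.subset_of_disjoint_nbhd
    (by rw [h.nbhd_eq]; exact hS.2.mono_right h'.subset_innerUnion) (by rwa [Set.inter_comm])
  rw [← h.nbhd_eq, ← h'.nbhd_eq, h1.antisymm h2]

end IsInner

/-- Every inner branch lies in an inner branch of a top bottleneck. -/
theorem exists_isTop_of_mem_innerUnion [Finite V] {I : Set V} {k : ℕ} {X : ℕ → Set V}
    (hX : IsSeqDecomposition G I k Set.univ X) {w : V} (hw : w ∈ innerUnion G k X) :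
    ∃ S H, IsTop G k X S ∧ IsInner G k X S H ∧ w ∈ H := by
  obtain ⟨S₀, H₀, h₀, hw₀⟩ := hw
  -- For a maximal inner branch `H`, a vertex of its bottleneck inside another inner branch `H'`
  -- would force `H ⊆ H'` strictly.
  obtain ⟨H, hsub, hmax⟩ := (Set.toFinite {H | ∃ S, IsInner G k X S H}).exists_le_maximal
    (show H₀ ∈ {H | ∃ S, IsInner G k X S H} from ⟨S₀, h₀⟩)
  obtain ⟨S, hS⟩ := hmax.prop
  refine ⟨S, H, ⟨hS.bottleneck, ?_⟩, hS, hsub hw₀⟩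
  rw [Set.disjoint_left]
  rintro s hs ⟨S', H', h', hsH'⟩
  have hd : Disjoint S' H :=
    (hS.disjoint_or_disjoint hX h').resolve_left (Set.not_disjoint_iff.2 ⟨s, hs, hsH'⟩)
  have hsN : s ∈ nbhd G H := hS.nbhd_eq ▸ hs
  obtain ⟨hsH, u, hu, hus⟩ := hsN
  have huH' : u ∈ H' := by
    by_contra hu'
    have huS : u ∈ S' := h'.nbhd_eq ▸ ⟨hu', s, hsH', hus.symm⟩
    exact Set.disjoint_left.1 hd huS hu
  have hHH' : H ⊆ H' :=
    hS.connSet.subset_of_disjoint_nbhd (by rwa [h'.nbhd_eq]) ⟨u, hu, huH'⟩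
  exact hsH (hmax.le_of_ge ⟨S', h'⟩ hHH' hsH')

/-- Removing the inner branches from an initial part of the decomposition keeps it rooted. -/
theorem conn_prefixUnion_diff_innerUnion {v : V} {k : ℕ} {X : ℕ → Set V}
    (hX : IsSeqDecomposition G {v} k Set.univ X) (i : ℕ) :
    ∀ x ∈ prefixUnion X i \ innerUnion G k X,
      Conn G (prefixUnion X i \ innerUnion G k X) x v := by
  induction i using Nat.strong_induction_on with
  | _ i ih =>
    rintro x ⟨hx, hxD⟩
    obtain ⟨hv, hc⟩ := componentsMeet_singleton_iff.1 (hX.rooted i) x hx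
    -- If the walk to `v` enters an inner branch, it does so from a vertex `a` of the bottleneck,
    -- which occurs in a strictly earlier bag; induction takes over from `a`.
    rcases hc.sdiff_or_exists_crossing hx hxD with
      ⟨h1, -⟩ | ⟨a, b, hxa, -, haD, ⟨j, hj, hbj⟩, hbD, hab⟩
    · exact h1
    · obtain ⟨S, H, hS, hbH⟩ := hbD
      have haS : a ∈ S := by
        rcases hS.mem_or_mem_of_adj hbH hab.symm with ha | ha
        · exact absurd (hS.subset_innerUnion ha) haD
        · exact ha
      obtain ⟨m, hm, ham⟩ := hS.before j ⟨b, hbj, hbH⟩ a haS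
      have hmi : m < i := by omega
      have hav := ih m hmi a ⟨⟨m, le_rfl, ham⟩, haD⟩
      exact hxa.trans (hav.mono (Set.sdiff_subset_sdiff_left (prefixUnion_mono X hmi.le)))

/-- The part of the decomposition inside an inner branch is rooted at the neighbours of the
bottleneck. -/
theorem IsInner.hasRootedDecomposition [Finite V] {v : V} {k : ℕ} {X : ℕ → Set V}
    (hX : IsSeqDecomposition G {v} k Set.univ X) (hX0 : X 0 = {v}) {S H : Set V}
    (h : IsInner G k X S H) {n : ℕ} (hnk : n ≤ k)
    (hn : ∀ j, S ⊆ X j → n ≤ (X j \ innerUnion G k X).ncard) :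
    HasRootedDecomposition (G.induce H) {w | (w : V) ∈ nbhd G S} ((k : ℤ) - n - 1) := by
  have hcast : (k : ℤ) - n - 1 = ((k - n : ℕ) : ℤ) - 1 := by rw [Nat.cast_sub hnk]
  rw [hcast, hasRootedDecomposition_iff]
  refine ⟨fun j => Subtype.val ⁻¹' X j, fun _ => Set.subset_univ _, ?_, ?_, ?_, ?_, ?_⟩
  · intro w _
    exact hX.covers w trivial
  · intro u _ w _ huw
    exact hX.edges u trivial w trivial huw
  · intro i j m hij hjm w hw
    exact hX.interval i j m hij hjm hw
  · intro j
    have him : (Subtype.val ⁻¹' X j : Set H).ncard = (X j ∩ H).ncard := by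
      rw [← Set.ncard_image_of_injective _ Subtype.val_injective, Subtype.image_preimage_coe,
        Set.inter_comm]
    rw [him]
    rcases Set.eq_empty_or_nonempty (X j ∩ H) with he | hne
    · rw [he, Set.ncard_empty]
      exact Nat.zero_le _
    -- A bag meeting `H` contains `S`, so at least `n` of its vertices lie outside all inner
    -- branches; at most `k - n` remain for `H`.
    · have h1 := hn j (h.subset_bag hX hne)
      have h2 : (X j ∩ H ∪ X j \ innerUnion G k X).ncard ≤ (X j).ncard :=
        Set.ncard_le_ncard (Set.union_subset Set.inter_subset_left Set.sdiff_subset)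
          (Set.toFinite _)
      rw [Set.ncard_union_eq (Set.disjoint_left.2 fun x hx hx' =>
        hx'.2 (h.subset_innerUnion hx.2)) (Set.toFinite _) (Set.toFinite _)] at h2
      have h3 := hX.card j
      omega
  · intro i
    rw [componentsMeet_iff]
    rintro x ⟨j, hj, hx⟩
    obtain ⟨-, hc⟩ := componentsMeet_singleton_iff.1 (hX.rooted i) x ⟨j, hj, hx⟩
    -- The root `v` is not in `H`, so the walk to it leaves `H`, necessarily from a vertex `a`
    -- adjacent to `S`.
    obtain ⟨a, b, hxa, hai, haH, -, hbH, hab⟩ :=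
      hc.exists_crossing (A := Hᶜ) ⟨j, hj, hx⟩ (fun hn => hn x.2) (h.root_notMem hX0)
    have haH' : a ∈ H := not_not.1 haH
    have hbS : b ∈ S := (h.mem_or_mem_of_adj haH' hab).resolve_left hbH
    refine ⟨⟨a, haH'⟩, hai, ⟨?_, b, hbS, hab.symm⟩, ?_⟩
    · intro haS
      rw [← h.nbhd_eq] at haS
      exact haS.1 haH'
    · have key : ∀ z, Conn G (prefixUnion X i \ Hᶜ) x z → ∃ hz : z ∈ H,
          Conn (G.induce H) (prefixUnion (fun j => Subtype.val ⁻¹' X j) i) x ⟨z, hz⟩ := by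
        intro z hz
        induction hz with
        | refl => exact ⟨x.2, ReflTransGen.refl⟩
        | tail _ hbc ih =>
          obtain ⟨hb, ih⟩ := ih
          exact ⟨not_not.1 hbc.2.1.2, ih.tail ⟨hbc.1.1, hbc.2.1.1, hbc.2.2⟩⟩
      exact (key a hxa).2

/-! ### Stages and canonical states -/

/-- The vertices outside the inner branches seen up to bag `i`, together with the inner branches
of the bottlenecks in `F`. -/
def stage (G : SimpleGraph V) (k : ℕ) (X : ℕ → Set V) (i : ℕ) (F : Set (Set V)) : Set V :=
  (prefixUnion X i \ innerUnion G k X) ∪ {w | ∃ S ∈ F, ∃ H, IsInner G k X S H ∧ w ∈ H}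

theorem stage_mono {k : ℕ} {X : ℕ → Set V} {i j : ℕ} {F F' : Set (Set V)} (hij : i ≤ j)
    (hF : F ⊆ F') : stage G k X i F ⊆ stage G k X j F' :=
  Set.union_subset_union (Set.sdiff_subset_sdiff_left (prefixUnion_mono X hij))
    fun _ ⟨S, hS, h⟩ => ⟨S, hF hS, h⟩

theorem bag_subset_stage {k : ℕ} {X : ℕ → Set V} {i : ℕ} {F : Set (Set V)} :
    X i \ innerUnion G k X ⊆ stage G k X i F :=
  fun _ hx => Or.inl ⟨⟨i, le_rfl, hx.1⟩, hx.2⟩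

theorem IsInner.subset_stage_iff {k : ℕ} {X : ℕ → Set V} {i : ℕ} {F : Set (Set V)}
    (hF : ∀ S ∈ F, IsTop G k X S) {S H : Set V} (h : IsInner G k X S H) (hS : IsTop G k X S) :
    H ⊆ stage G k X i F ↔ S ∈ F := by
  refine ⟨fun hsub => ?_, fun hSF x hx => Or.inr ⟨S, hSF, H, h, hx⟩⟩
  obtain ⟨x, hx⟩ := h.nonempty
  rcases hsub hx with hx' | ⟨S', hS', H', h', hx'⟩
  · exact absurd (h.subset_innerUnion hx) hx'.2
  · rw [h.eq_of_inter_nonempty h' hS (hF S' hS') ⟨x, hx, hx'⟩]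
    exact hS'

/-- The bottlenecks of `F` are attached to the first `i` bags, and all other top bottlenecks lie in
a bag of index at least `m`. -/
structure IsStageSet (G : SimpleGraph V) (k : ℕ) (X : ℕ → Set V) (i m : ℕ)
    (F : Set (Set V)) : Prop where
  isTop : ∀ S ∈ F, IsTop G k X S
  subset : ∀ S ∈ F, S ⊆ prefixUnion X i
  late : ∀ S, IsTop G k X S → S ∉ F → ∃ j, m ≤ j ∧ S ⊆ X j

section

variable {v : V} {k : ℕ} {X : ℕ → Set V}

theorem root_mem_stage (hX0 : X 0 = {v}) (i : ℕ) (F : Set (Set V)) : v ∈ stage G k X i F := by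
  refine Or.inl ⟨⟨0, Nat.zero_le i, by rw [hX0]; rfl⟩, ?_⟩
  rintro ⟨S, H, h, hvH⟩
  exact h.root_notMem hX0 hvH

theorem IsSeqDecomposition.conn_root (hX : IsSeqDecomposition G {v} k Set.univ X) (x : V) :
    Conn G Set.univ x v := by
  obtain ⟨i, hi⟩ := hX.covers x trivial
  exact (componentsMeet_singleton_iff.1 (hX.rooted i) x ⟨i, le_rfl, hi⟩).2.mono
    (Set.subset_univ _)

/-- The component condition is automatic: a walk in `cover(s)` from a new bag vertex to `v` enters
`cover(w)` at a border vertex, which lies in both bags, and until then runs through new vertices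
only, all of them in `bag(s)`. -/
theorem StepExt.of_root_mem {w s : State G k {v}} (hv : v ∈ w.cover) (hborder : w.border ⊆ s.bag)
    (hcover : s.cover = w.cover ∪ s.bag) (hbag : s.bag ∩ w.cover ⊆ w.bag) : StepExt w s := by
  refine ⟨?_, hborder, hcover, hbag⟩
  rw [componentsMeet_iff]
  intro x hx
  by_cases hxw : x ∈ w.cover
  · exact ⟨x, hx, hbag ⟨hx, hxw⟩, ReflTransGen.refl⟩
  · have hxs : x ∈ s.cover := s.bag_subset_cover hx
    obtain ⟨a, b, hxa, ha, haw, hb, hbw, hab⟩ :=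
      (componentsMeet_singleton_iff.1 s.rooted x hxs).2.exists_crossing hxs hxw hv
    have hsub : s.cover \ w.cover ⊆ s.bag := by
      rintro y ⟨hy, hyw⟩
      rw [hcover] at hy
      exact hy.resolve_left hyw
    have hbs : b ∈ s.bag := hborder ⟨hbw, a, haw, hab.symm⟩
    exact ⟨b, hbs, hbag ⟨hbs, hbw⟩,
      (hxa.mono hsub).tail ⟨hsub ⟨ha, haw⟩, hbs, hab⟩⟩

theorem IsStageSet.rooted (hX : IsSeqDecomposition G {v} k Set.univ X)
    {i m : ℕ} {F : Set (Set V)} (hF : IsStageSet G k X i m F) :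
    ComponentsMeet G (stage G k X i F) {v} := by
  refine ComponentsMeet.union_of_adj ?_ ?_
  · rw [componentsMeet_singleton_iff]
    intro x hx
    have hc := conn_prefixUnion_diff_innerUnion hX i x hx
    exact ⟨hc.mem hx, hc⟩
  · rintro x ⟨S, hS, H, h, hx⟩
    obtain ⟨s, hs⟩ := h.bottleneck.1
    have hsN : s ∈ nbhd G H := h.nbhd_eq ▸ hs
    obtain ⟨-, u, hu, hus⟩ := hsN
    have hsub : H ⊆ {w | ∃ S ∈ F, ∃ H, IsInner G k X S H ∧ w ∈ H} :=
      fun y hy => ⟨S, hS, H, h, hy⟩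
    exact ⟨u, ⟨S, hS, H, h, hu⟩, (h.connSet x hx u hu).mono hsub, s,
      ⟨hF.subset S hS hs, Set.disjoint_left.1 (hF.isTop S hS).2 hs⟩, hus⟩

variable [Finite V]

/-- The case `m = i` gives the border condition for canonical states, and `m = i + 1` the one for
step extensions. A border vertex next to an unabsorbed inner branch belongs to its top bottleneck,
which lies in a bag of index at least `m`, so the vertex persists until `X m`. -/
theorem IsStageSet.mem_bag_of_adj {I : Set V} (hX : IsSeqDecomposition G I k Set.univ X) {i m : ℕ}
    {F : Set (Set V)} (hF : IsStageSet G k X i m F) (him : i ≤ m) (hmi : m ≤ i + 1) {p q : V}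
    (hp : p ∈ stage G k X i F) (hq : q ∉ stage G k X i F) (hpq : G.Adj p q) :
    p ∈ X m \ innerUnion G k X := by
  rcases hp with ⟨⟨j, hj, hpj⟩, hpD⟩ | ⟨S, hS, H, h, hpH⟩
  · refine ⟨?_, hpD⟩
    by_cases hqD : q ∈ innerUnion G k X
    · obtain ⟨S, H, hS, h, hqH⟩ := exists_isTop_of_mem_innerUnion hX hqD
      have hSF : S ∉ F := fun hSF => hq (Or.inr ⟨S, hSF, H, h, hqH⟩)
      have hpS : p ∈ S := (h.mem_or_mem_of_adj hqH hpq.symm).resolve_left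
        fun hpH => hpD (h.subset_innerUnion hpH)
      obtain ⟨n, hn, hSn⟩ := hF.late S hS hSF
      exact hX.interval j m n (hj.trans him) hn ⟨hpj, hSn hpS⟩
    · obtain ⟨n, hpn, hqn⟩ := hX.edges p trivial q trivial hpq
      have hin : i < n := by
        by_contra hni
        exact hq (Or.inl ⟨⟨n, by omega, hqn⟩, hqD⟩)
      exact hX.interval j m n (hj.trans him) (by omega) ⟨hpj, hpn⟩
  · refine absurd ?_ hq
    rcases h.mem_or_mem_of_adj hpH hpq with hqH | hqS
    · exact Or.inr ⟨S, hS, H, h, hqH⟩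
    · exact Or.inl ⟨hF.subset S hS hqS, Set.disjoint_left.1 (hF.isTop S hS).2 hqS⟩

/-- The state with bag `Y` and cover `C` whose exceptional branches are the ones that are not
inner, and whose branches of value `1` are those inside `C` that avoid `Y`. -/
structure IsCanonical {I : Set V} (X : ℕ → Set V) (Y C : Set V) (s : State G k I) : Prop where
  bag : s.bag = Y
  cover : s.cover = C
  mem_B : ∀ S hne hS H, H ∈ s.B S hne hS ↔ ¬ IsInner G k X S H
  f_iff : ∀ S hne hS H, s.f S hne hS H = true ↔ (H : Set V) ⊆ C ∧ Disjoint (H : Set V) Y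

theorem exists_isCanonical {I : Set V} (hX : IsSeqDecomposition G {v} k Set.univ X) {Y C : Set V}
    (hne : Y.Nonempty) (hcard : Y.ncard ≤ k) (hYC : Y ⊆ C)
    (hborder : ∀ p ∈ C, ∀ q ∉ C, G.Adj p q → p ∈ Y) (hroot : ComponentsMeet G C I)
    (hYD : Disjoint Y (innerUnion G k X))
    (hconst : ∀ S ⊆ Y, ∀ H H', IsInner G k X S H → IsInner G k X S H' → H ⊆ C → H' ⊆ C) :
    ∃ s : State G k I, IsCanonical X Y C s := by
  classical
  let s : PotentialState G k :=
    { bag := Y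
      bag_nonempty := hne
      bag_card := hcard
      B := fun S _ _ => {H | ¬ IsInner G k X S H}
      B_card := fun S hS _ => hX.ncard_not_inner_le hS
      f := fun S _ _ H => decide ((H : Set V) ⊆ C ∧ Disjoint (H : Set V) Y)
      f_const := by
        intro S hSne hS H hH H' hH'
        have hH := not_not.1 hH
        have hH' := not_not.1 hH'
        rw [decide_eq_decide]
        exact ⟨fun h => ⟨hconst S hS _ _ hH hH' h.1,
            (hYD.mono_right hH'.subset_innerUnion).symm⟩,
          fun h => ⟨hconst S hS _ _ hH' hH h.1, (hYD.mono_right hH.subset_innerUnion).symm⟩⟩ }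
  have hcover : s.cover = C := by
    ext x
    constructor
    · rintro (hx | ⟨S, hSne, hS, H, hf, hx⟩)
      · exact hYC hx
      · exact (of_decide_eq_true hf).1 hx
    · intro hxC
      -- A vertex of `C \ Y` is covered by its component in `G - Y`. This is a branch of its own
      -- neighbourhood, which lies in `Y` and is nonempty because `G` is connected; it stays inside
      -- `C` because the border of `C` lies in `Y`.
      by_cases hxY : x ∈ Y
      · exact Or.inl hxY
      have hHY : ∀ y, Conn G Yᶜ x y → y ∉ Y := fun y hy => hy.mem hxY
      have hHC : {y | Conn G Yᶜ x y} ⊆ C := by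
        intro y hy
        by_contra hyC
        obtain ⟨a, b, -, -, haC, hb, hbC, hab⟩ :=
          (Conn.symm hy).exists_crossing (hHY y hy) hyC hxC
        exact hb (hborder b (by exact hbC) a haC hab.symm)
      have hN : nbhd G {y | Conn G Yᶜ x y} ⊆ Y := by
        rintro y ⟨hy, u, hu, huy⟩
        by_contra hyY
        exact hy (ReflTransGen.tail hu ⟨hHY u hu, hyY, huy⟩)
      have hNne : (nbhd G {y | Conn G Yᶜ x y}).Nonempty := by
        obtain ⟨y, hy⟩ := hne
        obtain ⟨a, b, hxa, -, haY, -, hb, hab⟩ :=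
          Conn.exists_crossing ((hX.conn_root x).trans (hX.conn_root y).symm) trivial hxY hy
        exact ⟨b, fun hb' => hHY b hb' hb, a, hxa.mono fun z hz => hz.2, hab⟩
      exact Or.inr ⟨_, hNne, hN,
        ⟨_, mem_branches_iff.2 ⟨⟨x, ReflTransGen.refl⟩, connSet_conn _ x, rfl⟩⟩,
        decide_eq_true ⟨hHC, Set.disjoint_left.2 hHY⟩, ReflTransGen.refl⟩
  refine ⟨⟨s, by rwa [hcover]⟩, rfl, hcover, fun _ _ _ _ => Iff.rfl, fun S _ _ H => ?_⟩
  exact decide_eq_true_iff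

theorem IsStageSet.exists_isCanonical (hX : IsSeqDecomposition G {v} k Set.univ X) {i : ℕ}
    {F : Set (Set V)} (hF : IsStageSet G k X i i F) (hne : (X i \ innerUnion G k X).Nonempty) :
    ∃ s : State G k {v}, IsCanonical X (X i \ innerUnion G k X) (stage G k X i F) s := by
  refine ConnPW.exists_isCanonical hX hne
    ((Set.ncard_le_ncard Set.sdiff_subset (Set.toFinite _)).trans (hX.card i)) bag_subset_stage
    (fun p hp q hq hpq => hF.mem_bag_of_adj hX le_rfl (Nat.le_succ i) hp hq hpq) (hF.rooted hX)
    Set.disjoint_sdiff_left ?_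
  intro S hS H H' h h' hsub
  have hS : IsTop G k X S := ⟨h.bottleneck, Set.disjoint_left.2 fun x hx => (hS hx).2⟩
  exact (h'.subset_stage_iff hF.isTop hS).2 ((h.subset_stage_iff hF.isTop hS).1 hsub)

theorem IsCanonical.jumpExt (hX : IsSeqDecomposition G {v} k Set.univ X) (hX0 : X 0 = {v}) {i : ℕ}
    {F : Set (Set V)} {S' : Set V} (hF : ∀ S ∈ F, IsTop G k X S) (hS' : IsTop G k X S')
    (hS'F : S' ∉ F) (hS'i : S' ⊆ X i)
    (hmin : ∀ j, S' ⊆ X j → (X i \ innerUnion G k X).ncard ≤ (X j \ innerUnion G k X).ncard)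
    {w s : State G k {v}} (hw : IsCanonical X (X i \ innerUnion G k X) (stage G k X i F) w)
    (hs : IsCanonical X (X i \ innerUnion G k X) (stage G k X i (insert S' F)) s) :
    JumpExt w s := by
  have hS'Y : S' ⊆ X i \ innerUnion G k X :=
    fun x hx => ⟨hS'i hx, Set.disjoint_left.1 hS'.2 hx⟩
  have hFF : ∀ S ∈ insert S' F, IsTop G k X S := by
    rintro S (rfl | hS)
    · exact hS'
    · exact hF S hS
  have hcov : ∀ H : Set V, (∀ K, IsInner G k X S' K → Disjoint H K) →
      (H ⊆ stage G k X i F ↔ H ⊆ stage G k X i (insert S' F)) := by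
    intro H hH
    refine ⟨fun h => h.trans (stage_mono le_rfl (Set.subset_insert _ _)), fun h x hx => ?_⟩
    rcases h hx with hx' | ⟨S, rfl | hS, K, hK, hxK⟩
    · exact Or.inl hx'
    · exact absurd hxK (Set.disjoint_left.1 (hH K hK) hx)
    · exact Or.inr ⟨S, hS, K, hK, hxK⟩
  refine ⟨hw.bag.trans hs.bag.symm, ?_, S', hS'.1.1, hw.bag.symm ▸ hS'Y, hs.bag.symm ▸ hS'Y,
    hS'.1, ?_, ?_, ?_, ?_⟩
  · intro S hne h1 h2
    ext H
    rw [hw.mem_B, hs.mem_B]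
  · intro H hH
    rw [hw.mem_B, not_not] at hH
    constructor
    · rw [Bool.eq_false_iff, Ne, hw.f_iff, hH.subset_stage_iff hF hS']
      exact fun h => hS'F h.1
    · rw [hs.f_iff, hH.subset_stage_iff hFF hS']
      exact ⟨Or.inl rfl, (Set.disjoint_sdiff_left.mono_right hH.subset_innerUnion).symm⟩
  · intro H hH
    rw [hw.mem_B] at hH
    rw [Bool.eq_iff_iff, hw.f_iff, hs.f_iff]
    refine and_congr_left fun _ => hcov _ fun K hK => ?_
    by_contra hnd
    rw [Set.not_disjoint_iff_nonempty_inter] at hnd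
    rw [eq_of_branches_inter_nonempty H.2 hK.branch hnd] at hH
    exact hH hK
  · intro S hne hSw hSs hSS' H
    rw [Bool.eq_iff_iff, hw.f_iff, hs.f_iff]
    -- A branch of another `S` that avoids the bag and meets an inner branch `K` of `S'` would equal
    -- `K`, forcing `S = S'`.
    refine and_congr_left fun hHY => hcov _ fun K hK => ?_
    by_contra hnd
    rw [Set.not_disjoint_iff_nonempty_inter] at hnd
    obtain ⟨-, hHc, hHS⟩ := mem_branches_iff.1 H.2
    have hSY : S ⊆ X i \ innerUnion G k X := hw.bag ▸ hSw
    have h1 : (H : Set V) ⊆ K := hHc.subset_of_disjoint_nbhd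
      (by rw [hK.nbhd_eq]; exact (hHY.mono_right hS'Y).symm) hnd
    have h2 : K ⊆ (H : Set V) := hK.connSet.subset_of_disjoint_nbhd
      (by rw [hHS]; exact Set.disjoint_sdiff_left.mono hSY hK.subset_innerUnion)
      (by rwa [Set.inter_comm])
    exact hSS' (by rw [← hHS, ← hK.nbhd_eq, h1.antisymm h2])
  · intro H hH
    rw [hw.mem_B, not_not] at hH
    refine hH.hasRootedDecomposition hX hX0 w.bag_card ?_
    rw [hw.bag]
    exact hmin

theorem IsStageSet.stepExt (hX : IsSeqDecomposition G {v} k Set.univ X) (hX0 : X 0 = {v}) {i : ℕ}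
    {F : Set (Set V)} (hF : IsStageSet G k X i (i + 1) F) {w s : State G k {v}}
    (hwb : w.bag = X i \ innerUnion G k X) (hwc : w.cover = stage G k X i F)
    (hsb : s.bag = X (i + 1) \ innerUnion G k X) (hsc : s.cover = stage G k X (i + 1) F) :
    StepExt w s := by
  refine StepExt.of_root_mem (hwc ▸ root_mem_stage hX0 i F) ?_ ?_ ?_
  · rintro p ⟨hp, q, hq, hpq⟩
    rw [hwc] at hp hq
    rw [hsb]
    exact hF.mem_bag_of_adj hX (Nat.le_succ i) le_rfl hp hq hpq
  · rw [hsc, hwc, hsb]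
    refine (Set.union_subset (stage_mono (Nat.le_succ i) subset_rfl) bag_subset_stage).antisymm' ?_
    rintro x (⟨⟨j, hj, hx⟩, hxD⟩ | hx)
    · rcases Nat.le_succ_iff.1 hj with hj | rfl
      · exact Or.inl (Or.inl ⟨⟨j, hj, hx⟩, hxD⟩)
      · exact Or.inr ⟨hx, hxD⟩
    · exact Or.inl (Or.inr hx)
  · rw [hsb, hwc, hwb]
    rintro x ⟨⟨hx, hxD⟩, ⟨⟨j, hj, hxj⟩, -⟩ | ⟨S, -, H, h, hxH⟩⟩
    · exact ⟨hX.interval j i (i + 1) hj (Nat.le_succ i) ⟨hxj, hx⟩, hxD⟩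
    · exact absurd (h.subset_innerUnion hxH) hxD

theorem StepExt.tab {ord : ProcessingOrder G k {v}} {w s : State G k {v}} (h : StepExt w s)
    (hd : Distinguishable w s) (hw : Tab ord w) : Tab ord s := by
  refine hw.of_ext ?_ hd ?_ (Or.inl h)
  · rw [h.cover]
    exact Set.subset_union_left
  · intro hc x hx
    exact h.bag ⟨hx, hc ▸ s.bag_subset_cover hx⟩

/-! ### Following a decomposition through the table -/

theorem IsTop.exists_isInner {I : Set V} (hX : IsSeqDecomposition G I k Set.univ X) {S : Set V}
    (hS : IsTop G k X S) : ∃ H, IsInner G k X S H := by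
  by_contra hno
  push Not at hno
  have h1 := hX.ncard_not_inner_le hS.1.1
  have h2 := hS.1.2
  have h3 : {H : branches G S | ¬ IsInner G k X S H} = Set.univ :=
    Set.eq_univ_of_forall fun H => hno H
  rw [h3, Set.ncard_univ, Nat.card_coe_set_eq] at h1
  omega

/-- The place at which the inner branches of a top bottleneck are inserted: the first bag containing
the bottleneck that is smallest outside the inner branches. -/
theorem IsTop.exists_place {I : Set V} (hX : IsSeqDecomposition G I k Set.univ X) {S : Set V}
    (hS : IsTop G k X S) : ∃ t, S ⊆ X t ∧
      (∀ j, S ⊆ X j → (X t \ innerUnion G k X).ncard ≤ (X j \ innerUnion G k X).ncard) ∧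
      ∀ j < t, S ⊆ X j → (X t \ innerUnion G k X).ncard < (X j \ innerUnion G k X).ncard := by
  classical
  obtain ⟨H, h⟩ := hS.exists_isInner hX
  obtain ⟨j, hj⟩ := h.exists_hit hX
  have e : ∃ n, ∃ t, S ⊆ X t ∧ (X t \ innerUnion G k X).ncard = n :=
    ⟨_, j, h.subset_bag hX hj, rfl⟩
  have e' := Nat.find_spec e
  obtain ⟨h1, h2⟩ := Nat.find_spec e'
  have hle : ∀ j, S ⊆ X j → (X (Nat.find e') \ innerUnion G k X).ncard ≤
      (X j \ innerUnion G k X).ncard := by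
    intro j hj
    rw [h2]
    exact Nat.find_min' e ⟨j, hj, rfl⟩
  refine ⟨Nat.find e', h1, hle, fun j hjt hj => lt_of_le_of_ne (hle j hj) fun heq => ?_⟩
  exact Nat.find_min e' hjt ⟨hj, heq.symm.trans h2⟩

/-- Completeness of the table. -/
theorem exists_tab_of_seq {ord : ProcessingOrder G k {v}}
    (hX : IsSeqDecomposition G {v} k Set.univ X) (hX0 : X 0 = {v}) :
    ∃ s : State G k {v}, Tab ord s ∧ s.cover = Set.univ := by
  have hplace : ∀ S, ∃ t, IsTop G k X S → S ⊆ X t ∧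
      (∀ j, S ⊆ X j → (X t \ innerUnion G k X).ncard ≤ (X j \ innerUnion G k X).ncard) ∧
      ∀ j < t, S ⊆ X j → (X t \ innerUnion G k X).ncard < (X j \ innerUnion G k X).ncard := by
    intro S
    by_cases hS : IsTop G k X S
    · obtain ⟨t, ht⟩ := hS.exists_place hX
      exact ⟨t, fun _ => ht⟩
    · exact ⟨0, fun h => absurd h hS⟩
  choose t ht using hplace
  have hstage : ∀ i m F, (∀ S ∈ F, IsTop G k X S ∧ t S ≤ i) →
      (∀ S, IsTop G k X S → t S < m → S ∈ F) → IsStageSet G k X i m F := by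
    intro i m F h1 h2
    refine ⟨fun S hS => (h1 S hS).1, fun S hS x hx => ?_, fun S hS hSF => ?_⟩
    · exact ⟨t S, (h1 S hS).2, (ht S (h1 S hS).1).1 hx⟩
    · exact ⟨t S, by by_contra hlt; exact hSF (h2 S hS (by omega)), (ht S hS).1⟩
  let before : ℕ → Set (Set V) := fun i => {S | IsTop G k X S ∧ t S < i}
  let upTo : ℕ → Set (Set V) := fun i => {S | IsTop G k X S ∧ t S ≤ i}
  have hjumps : ∀ i (w : State G k {v}), Tab ord w →
      IsCanonical X (X i \ innerUnion G k X) (stage G k X i (before i)) w →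
      ∃ s : State G k {v}, Tab ord s ∧
        IsCanonical X (X i \ innerUnion G k X) (stage G k X i (upTo i)) s := by
    intro i w hw hcan
    have hne : (X i \ innerUnion G k X).Nonempty := hcan.bag ▸ w.bag_nonempty
    have key : ∀ A : Set (Set V), A.Finite → (∀ S ∈ A, IsTop G k X S ∧ t S = i) →
        ∃ s : State G k {v}, Tab ord s ∧
          IsCanonical X (X i \ innerUnion G k X) (stage G k X i (A ∪ before i)) s := by
      intro A hA
      induction A, hA using Set.Finite.induction_on with
      | empty =>
        intro _
        rw [Set.empty_union]
        exact ⟨w, hw, hcan⟩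
      | @insert S A hSA _ ih =>
        intro hsub
        obtain ⟨w, hw, hcan⟩ := ih fun T hT => hsub T (Or.inr hT)
        obtain ⟨hS, hSi⟩ := hsub S (Or.inl rfl)
        have hmem : ∀ T ∈ insert S A ∪ before i, IsTop G k X T ∧ t T ≤ i := by
          rintro T (hT | hT)
          · exact ⟨(hsub T hT).1, (hsub T hT).2.le⟩
          · exact ⟨hT.1, hT.2.le⟩
        obtain ⟨s, hs⟩ := (hstage i i (insert S A ∪ before i) hmem
          fun T hT hlt => Or.inr ⟨hT, hlt⟩).exists_isCanonical hX hne
        have hSF : S ∉ A ∪ before i := by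
          rintro (h | h)
          · exact hSA h
          · exact absurd hSi h.2.ne
        have hFtop : ∀ T ∈ A ∪ before i, IsTop G k X T := fun T hT =>
          (hmem T (hT.imp_left Or.inr)).1
        obtain ⟨hSX, hSmin, -⟩ := ht S hS
        rw [hSi] at hSX hSmin
        refine ⟨s, ?_, hs⟩
        rw [Set.insert_union] at hs
        have hcov : w.cover ≠ s.cover := by
          rw [hcan.cover, hs.cover]
          intro heq
          obtain ⟨H, h⟩ := hS.exists_isInner hX
          refine hSF ((h.subset_stage_iff hFtop hS (i := i)).1 ?_)
          rw [heq]
          exact fun x hx => Or.inr ⟨S, Or.inl rfl, H, h, hx⟩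
        refine hw.of_ext ?_ (fun h => hcov h.1) (fun h => absurd h hcov)
          (Or.inr (hcan.jumpExt hX hX0 hFtop hS hSF hSX hSmin hs))
        rw [hcan.cover, hs.cover]
        exact stage_mono le_rfl (Set.subset_insert _ _)
    obtain ⟨s, hs, hcan'⟩ := key {S | IsTop G k X S ∧ t S = i} (Set.toFinite _) fun S hS => hS
    refine ⟨s, hs, ?_⟩
    have : {S | IsTop G k X S ∧ t S = i} ∪ before i = upTo i := by
      ext S
      constructor
      · rintro (hS | hS)
        · exact ⟨hS.1, hS.2.le⟩
        · exact ⟨hS.1, hS.2.le⟩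
      · rintro ⟨hS, hSi⟩
        rcases hSi.eq_or_lt with h | h
        · exact Or.inl ⟨hS, h⟩
        · exact Or.inr ⟨hS, h⟩
    rwa [this] at hcan'
  have hmain : ∀ i, ∃ w : State G k {v}, Tab ord w ∧
      ((w.bag = X i \ innerUnion G k X ∧ w.cover = stage G k X i (upTo i)) ∨
        w.cover = Set.univ) := by
    intro i
    induction i with
    | zero =>
      have hvD : v ∉ innerUnion G k X := fun ⟨S, H, h, hvH⟩ => h.root_notMem hX0 hvH
      have hY : X 0 \ innerUnion G k X = {v} := by
        rw [hX0, sdiff_eq_left]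
        exact Set.disjoint_singleton_left.2 hvD
      have hbef : before 0 = ∅ := Set.eq_empty_of_forall_notMem fun S hS => Nat.not_lt_zero _ hS.2
      have hC : stage G k X 0 (before 0) = {v} := by
        rw [hbef]
        ext x
        constructor
        · rintro (⟨⟨j, hj, hx⟩, -⟩ | ⟨S, hS, -⟩)
          · rw [Nat.le_zero.1 hj, hX0] at hx
            exact hx
          · exact hS.elim
        · intro hx
          rw [Set.mem_singleton_iff.1 hx]
          exact root_mem_stage hX0 0 ∅
      obtain ⟨w, hw⟩ := (hstage 0 0 (before 0) (fun S hS => ⟨hS.1, hS.2.le⟩)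
        fun S hS hlt => ⟨hS, hlt⟩).exists_isCanonical hX (hY ▸ Set.singleton_nonempty v)
      have hwT : Tab ord w :=
        Tab.of_init ord ⟨v, rfl, hw.cover.trans hC, hw.bag.trans hY⟩
      obtain ⟨s, hs, hcan⟩ := hjumps 0 w hwT hw
      exact ⟨s, hs, Or.inl ⟨hcan.bag, hcan.cover⟩⟩
    | succ i ih =>
      obtain ⟨w, hw, ⟨hwb, hwc⟩ | hwu⟩ := ih
      swap
      · exact ⟨w, hw, Or.inr hwu⟩
      by_cases hwu : w.cover = Set.univ
      · exact ⟨w, hw, Or.inr hwu⟩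
      have hF : IsStageSet G k X i (i + 1) (upTo i) :=
        hstage i (i + 1) _ (fun S hS => hS) fun S hS hlt => ⟨hS, Nat.lt_succ_iff.1 hlt⟩
      have hupTo : upTo i = before (i + 1) := by
        ext S
        exact and_congr_right fun _ => Nat.lt_succ_iff.symm
      -- Deleting inner branches could empty a bag, but as long as the cover is not everything it
      -- has a border vertex, and this lies in the next bag.
      have hne : (X (i + 1) \ innerUnion G k X).Nonempty := by
        obtain ⟨q, hq⟩ := (Set.ne_univ_iff_exists_notMem _).1 hwu
        rw [hwc] at hq
        obtain ⟨a, b, -, -, ha, -, hb, hab⟩ :=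
          (hX.conn_root q).exists_crossing trivial hq (root_mem_stage hX0 i (upTo i))
        exact ⟨b, hF.mem_bag_of_adj hX (Nat.le_succ i) le_rfl hb ha hab.symm⟩
      obtain ⟨s, hs⟩ := (hstage (i + 1) (i + 1) (before (i + 1)) (fun S hS => ⟨hS.1, hS.2.le⟩)
        fun S hS hlt => ⟨hS, hlt⟩).exists_isCanonical hX hne
      have hstep : StepExt w s := hF.stepExt hX hX0 hwb hwc hs.bag (hupTo ▸ hs.cover)
      by_cases hd : Distinguishable w s
      · obtain ⟨s', hs', hcan⟩ := hjumps (i + 1) s (hstep.tab hd hw) hs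
        exact ⟨s', hs', Or.inl ⟨hcan.bag, hcan.cover⟩⟩
      -- Here the table permits no extension, so `w` itself must serve at `i + 1`. No jump is due
      -- there: the two reduced bags coincide, so a bottleneck placed at `i + 1` would have been
      -- placed earlier. This is why the place is the first minimiser.
      · obtain ⟨hc, hb⟩ := not_not.1 hd
        have hYY : X i \ innerUnion G k X = X (i + 1) \ innerUnion G k X := by
          rw [← hwb, hb, hs.bag]
        have hup : upTo (i + 1) = before (i + 1) := by
          ext S
          refine and_congr_right fun hS => ⟨fun hle => lt_of_le_of_ne hle fun heq => ?_, le_of_lt⟩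
          obtain ⟨hSX, -, hlt⟩ := ht S hS
          rw [heq] at hSX hlt
          have hSY : S ⊆ X (i + 1) \ innerUnion G k X :=
            fun x hx => ⟨hSX hx, Set.disjoint_left.1 hS.2 hx⟩
          rw [← hYY] at hSY hlt
          exact lt_irrefl _ (hlt i (Nat.lt_succ_self i) (hSY.trans Set.sdiff_subset))
        exact ⟨w, hw, Or.inl ⟨hwb.trans hYY, by rw [hc, hs.cover, hup]⟩⟩
  have hmem : ∀ x, ∃ i, x ∈ stage G k X i (upTo i) := by
    intro x
    by_cases hxD : x ∈ innerUnion G k X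
    · obtain ⟨S, H, hS, h, hx⟩ := exists_isTop_of_mem_innerUnion hX hxD
      exact ⟨t S, Or.inr ⟨S, ⟨hS, le_rfl⟩, H, h, hx⟩⟩
    · obtain ⟨i, hi⟩ := hX.covers x trivial
      exact ⟨i, bag_subset_stage ⟨hi, hxD⟩⟩
  choose a ha using hmem
  obtain ⟨n, hn⟩ := (Set.finite_range a).bddAbove
  obtain ⟨w, hw, ⟨-, hwc⟩ | hwu⟩ := hmain n
  · refine ⟨w, hw, Set.eq_univ_of_forall fun x => ?_⟩
    rw [hwc]
    have hax : a x ≤ n := hn ⟨x, rfl⟩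
    have hsub : upTo (a x) ⊆ upTo n := fun S hS => ⟨hS.1, hS.2.trans hax⟩
    exact stage_mono hax hsub (ha x)
  · exact ⟨w, hw, hwu⟩

end

/-! ### Correctness and connected pathwidth -/

theorem exists_tab_iff [Finite V] {v : V} {k : ℕ} (ord : ProcessingOrder G k {v}) :
    (∃ s : State G k {v}, Tab ord s ∧ s.cover = Set.univ) ↔
      HasRootedDecomposition G {v} ((k : ℤ) - 1) := by
  refine ⟨fun ⟨s, hs, hc⟩ => hs.hasRootedDecomposition hc, fun h => ?_⟩
  obtain ⟨X, hX⟩ := h.exists_seq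
  obtain ⟨Y, hY, hY0⟩ := hX.exists_zero_eq_singleton
  exact exists_tab_of_seq hY hY0

/-- Once the first bag is `{v}`, every prefix is connected through `v`; conversely any vertex of the
first bag of a connected decomposition is a root. The form `cpw G + 1 ≤ k` avoids truncated
subtraction at `k = 0`, where both sides fail. -/
theorem exists_hasRootedDecomposition_iff [Finite V] (G : SimpleGraph V) (k : ℕ) :
    (∃ v, HasRootedDecomposition G {v} ((k : ℤ) - 1)) ↔ cpw G + 1 ≤ (k : ℕ∞) := by
  constructor
  · rintro ⟨v, h⟩
    obtain ⟨X, hX⟩ := h.exists_seq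
    obtain ⟨Y, hY, hY0⟩ := hX.exists_zero_eq_singleton
    obtain ⟨P, hP, hw, hu⟩ := exists_list_of_seq hY
    have hPc : IsConnectedSeq G P := by
      intro i h1 hi
      rw [hu i h1 hi]
      have hv : v ∈ prefixUnion Y (i - 1) := ⟨0, Nat.zero_le _, by rw [hY0]; rfl⟩
      have hc := componentsMeet_singleton_iff.1 (hY.rooted (i - 1))
      have : Nonempty (prefixUnion Y (i - 1)) := ⟨⟨v, hv⟩⟩
      refine ⟨fun x y => ?_⟩
      rw [reachable_induce_iff]
      exact (hc x x.2).2.trans (hc y y.2).2.symm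
    have hk : 1 ≤ k := by
      have := hY.card 0
      rwa [hY0, Set.ncard_singleton] at this
    have hle : cpw G ≤ ((k - 1 : ℕ) : ℕ∞) :=
      (iInf₂_le P ⟨hP, hPc⟩).trans (by exact_mod_cast (by omega : (width P).toNat ≤ k - 1))
    calc cpw G + 1 ≤ ((k - 1 : ℕ) : ℕ∞) + 1 := by gcongr
      _ = (k : ℕ∞) := by exact_mod_cast Nat.sub_add_cancel hk
  · intro h
    have hlt : cpw G < (k : ℕ∞) := by
      refine (ENat.add_one_le_iff ?_).1 h
      rintro htop
      rw [htop] at h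
      exact absurd h (by simp)
    obtain ⟨P, hP⟩ := iInf_lt_iff.1 hlt
    obtain ⟨⟨hPd, hPc⟩, hw⟩ := iInf_lt_iff.1 hP
    have hw' : (width P).toNat < k := by exact_mod_cast hw
    have hpos : 1 ≤ P.length := List.length_pos_iff.2 hPd.ne_nil
    obtain ⟨⟨v, hv⟩⟩ := (hPc 1 le_rfl hpos).nonempty
    refine ⟨v, P, hPd, ?_, by omega⟩
    intro i h1 hi
    have hvi : v ∈ unionOf (P.take i) := by
      obtain ⟨Z, hZ, hvZ⟩ := hv
      exact ⟨Z, List.take_subset_take_left P h1 hZ, hvZ⟩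
    rw [componentsMeet_singleton_iff]
    intro x hx
    exact ⟨hvi, (reachable_induce_iff _ _).1 ((hPc i h1 hi).preconnected ⟨x, hx⟩ ⟨v, hvi⟩)⟩

end ConnPW

theorem mainTheorem3 {V : Type*} [Finite V] (G : SimpleGraph V) (k : ℕ)
    (ord : ∀ v : V, ConnPW.ProcessingOrder G k {v}) :
    (∀ v : V,
      (∃ s : ConnPW.State G k {v}, ConnPW.Tab (ord v) s ∧ s.cover = Set.univ) ↔
        ConnPW.HasRootedDecomposition G {v} ((k : ℤ) - 1)) ∧
    ((∃ (v : V) (s : ConnPW.State G k {v}), ConnPW.Tab (ord v) s ∧ s.cover = Set.univ) ↔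
      ConnPW.cpw G + 1 ≤ (k : ℕ∞)) := by
  refine ⟨fun v => ConnPW.exists_tab_iff (ord v), ?_⟩
  rw [← ConnPW.exists_hasRootedDecomposition_iff]
  exact exists_congr fun v => ConnPW.exists_tab_iff (ord v)
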